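/- Let $G$ be a group and let $n\ge 0$. Let $\mathcal I_n$ be the symmetric inverse monoid of partial bijections $a$ of $[n]=\{1,\dots,n\}$, acting on the right, so that $ab$ means "first $a$, then $b$". The partial wreath product $G\wr\mathcal I_n$ (isomorphic to the partial automorphism monoid of the free $G$-act of rank $n$) consists of the pairs $(g;a)$ with $g\in(G\cup\{0\})^n$, $a\in\mathcal I_n$ and $g_i\neq 0\iff i\in\operatorname{dom}a$, with multiplication $(g;a)(h;b)=(g\,h_a;ab)$, where $(h_a)_i=h_{ia}$, read as $0$ if $ia$ is undefined. The rank of $(g;a)$ is $|\operatorname{im}a|$. Let $I_k$ be the ideal of the elements of rank at most $k$ ($I_{-1}=\emptyset$), $I_k^\star=(I_k\times I_k)\cup\iota$ its Rees congruence ($\iota$ is equality), and $D_m=I_m\setminus I_{m-1}$. Let $G\wr\mathcal S_m=G^m\rtimes\mathcal S_m$, with $(g,a)(h,b)=(g\,h^a,ab)$ and $(h^a)_i=h_{ia}$. Let $\pi_{i}:G^{i}\to G^{i-1}$ be the projection onto the first $i-1$ coordinates. A subgroup of $G^i$ is invariant if it is stable under all permutations of the coordinates. A datum $(m,\{T_i\},L)$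 consists of an integer $0\le m\le n$, invariant normal subgroups $T_i\trianglelefteq G^i$ for $m+1\le i\le n$ that form a closed family, i.e. $T_{i}\pi_{i}\subseteq T_{i-1}$ for $m+2\le i\le n$, and a normal subgroup $L\trianglelefteq G\wr\mathcal S_m$ such that $(t,1)\in L$ for all $t\in T_{m+1}\pi_{m+1}$ (no condition if $m=n$). Given a datum, let $\sigma_L$ be the relation on the principal factor $I_m/I_{m-1}$ that relates $u$ and $v$ if $u\mathrel{\mathcal H}v$ and $u^{-1}v\in L_{u^{-1}u}$, and relates zero to itself; here, for an idempotent $e$ of rank $m$, $L_e$ is the preimage of $L$ under the isomorphism $H_e\to G\wr\mathcal S_m$ obtained by identifying $\operatorname{dom}e$ with $[m]$ in increasing order. Let $\overline{\sigma_L}$ be the lift of $\sigma_L$ to $D_m$, that is, the set of pairs in $D_m\times D_m$ whose classes in $I_m/I_{m-1}$ are related by $\sigma_L$. For subgroups $K_i\le G^i$ let $\chi(K_1,\dots,K_n)$ be the set of pairs $((g;a),(h;a))$ such that the nonzero entries of $h^{-1}g$, in increasing order of position, form an element of $K_{i}$, where $i=\operatorname{rank}(a)$ (no condition if $i=0$).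 Put $$\chi=\chi(G,G^2,\dots,G^{m-1},T_{m+1}\pi_{m+1},T_{m+1},\dots,T_n),\qquad \rho(m,\{T_i\},L)=I_{m-1}^\star\cup\overline{\sigma_L}\cup\chi,$$ where $T_{m+1}\pi_{m+1}$ is read as the trivial subgroup of $G^m$ if $m=n$. (1) For every datum, $I_{m-1}^\star$ is a congruence on $G\wr\mathcal I_n$, $\sigma_L$ is a congruence on $I_m/I_{m-1}$, $\chi$ is an idempotent-separating congruence on $G\wr\mathcal I_n$, and their union in the above sense, $\rho(m,\{T_i\},L)$, is a congruence on $G\wr\mathcal I_n$. (2) Conversely, every congruence on $G\wr\mathcal I_n$ other than the universal congruence $I_n^\star$ is equal to $\rho(m,\{T_i\},L)$ for some datum with $1\le m\le n$. -/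

import Mathlib

/-- The partial wreath product `G ≀ I_n`: pairs `(g; a)` with `g ∈ (G ∪ {0})^n` and `a` a partial
bijection of an `n`-element set, such that `g_i ≠ 0` exactly when `i ∈ dom a`. -/
@[ext] structure PWreath (G : Type*) [Group G] (n : ℕ) where
  /-- the labels `g` -/
  lab : Fin n → WithZero G
  /-- the partial bijection `a` -/
  map : Fin n ≃. Fin n
  lab_ne_zero_iff : ∀ i, lab i ≠ 0 ↔ (map i).isSome = true

namespace PWreath

variable {G : Type*} [Group G] {n : ℕ}

theorem lab_eq_zero {x : PWreath G n} {i : Fin n} (h : x.map i = none) : x.lab i = 0 := by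
  by_contra hc
  have := (x.lab_ne_zero_iff i).1 hc
  simp [h] at this

theorem lab_ne_zero {x : PWreath G n} {i j : Fin n} (h : x.map i = some j) : x.lab i ≠ 0 :=
  (x.lab_ne_zero_iff i).2 (by simp [h])

/-- For `a` a partial bijection and `h ∈ (G ∪ {0})^n`, the tuple `h_a = (h_{1a}, …, h_{na})`,
with `h_{ia} = 0` when `ia` is undefined. -/
def pull (a : Fin n ≃. Fin n) (h : Fin n → WithZero G) : Fin n → WithZero G :=
  fun i => (a i).elim 0 h

/-- `(g; a)(h; b) = (g h_a; ab)`; partial maps act on the right, so `ab` is `a` followed by `b`. -/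
instance : Mul (PWreath G n) where
  mul x y :=
    { lab := fun i => x.lab i * pull x.map y.lab i
      map := x.map.trans y.map
      lab_ne_zero_iff := by
        intro i
        rcases h : x.map i with _ | j
        · simp [pull, PEquiv.trans, h]
        · simp [pull, PEquiv.trans, h, lab_ne_zero h, ← y.lab_ne_zero_iff j] }

instance : One (PWreath G n) where
  one :=
    { lab := fun _ => 1
      map := PEquiv.refl _
      lab_ne_zero_iff := by simp }

/-- `(g; a)⁻¹ = ((g⁻¹)_{a⁻¹}; a⁻¹)`, where `0⁻¹ = 0`. -/
instance : Inv (PWreath G n) where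
  inv x :=
    { lab := pull x.map.symm (fun i => (x.lab i)⁻¹)
      map := x.map.symm
      lab_ne_zero_iff := by
        intro i
        rcases h : x.map.symm i with _ | j
        · simp [pull, h]
        · have hj : x.map j = some i := (PEquiv.eq_some_iff x.map).1 h
          simp [pull, h, lab_ne_zero hj] }

theorem mul_lab (x y : PWreath G n) (i : Fin n) :
    (x * y).lab i = x.lab i * (x.map i).elim 0 y.lab := rfl

theorem mul_map (x y : PWreath G n) : (x * y).map = x.map.trans y.map := rfl

theorem mul_map_apply (x y : PWreath G n) (i : Fin n) :
    (x * y).map i = (x.map i).bind y.map := rfl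

instance : Monoid (PWreath G n) where
  mul_assoc x y z := by
    ext1
    · funext i
      simp only [mul_lab, mul_map_apply]
      rcases h : x.map i with _ | j
      · simp
      · simp [mul_lab, mul_assoc]
    · simp only [mul_map, PEquiv.trans_assoc]
  one_mul x := by
    ext1
    · funext i
      change (1 : WithZero G) * x.lab i = x.lab i
      simp
    · exact PEquiv.refl_trans _
  mul_one x := by
    ext1
    · funext i
      rw [mul_lab]
      rcases h : x.map i with _ | j
      · simp [lab_eq_zero h]
      · change x.lab i * (1 : WithZero G) = x.lab i
        simp
    · exact PEquiv.trans_refl _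

/-- The domain of the underlying partial bijection. -/
def dom (x : PWreath G n) : Finset (Fin n) :=
  Finset.univ.filter fun i => (x.map i).isSome = true

/-- The rank of `(g; a)`: the number of points on which the injective partial map `a` is defined
(equivalently, the number of points of its image). -/
def rank (x : PWreath G n) : ℕ := x.dom.card

theorem mem_dom {x : PWreath G n} {i : Fin n} : i ∈ x.dom ↔ ∃ j, x.map i = some j := by
  rw [dom, Finset.mem_filter, Option.isSome_iff_exists]
  simp

theorem mem_dom_mul {x y : PWreath G n} {i : Fin n} :
    i ∈ (x * y).dom ↔ ∃ j, x.map i = some j ∧ j ∈ y.dom := by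
  simp only [mem_dom, mul_map_apply, Option.bind_eq_some_iff]
  exact ⟨fun ⟨k, j, hj, hk⟩ => ⟨j, hj, k, hk⟩, fun ⟨j, hj, k, hk⟩ => ⟨k, j, hj, hk⟩⟩

theorem rank_mul_le_left (x y : PWreath G n) : (x * y).rank ≤ x.rank := by
  apply Finset.card_le_card
  intro i hi
  obtain ⟨j, hj, -⟩ := mem_dom_mul.1 hi
  exact mem_dom.2 ⟨j, hj⟩

theorem rank_mul_le_right (x y : PWreath G n) : (x * y).rank ≤ y.rank := by
  apply Finset.card_le_card_of_injOn (fun i => (x.map i).getD i)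
  · intro i hi
    obtain ⟨j, hj, hy⟩ := mem_dom_mul.1 (Finset.mem_coe.1 hi)
    simpa [hj] using hy
  · intro i hi k hk hik
    obtain ⟨j, hj, -⟩ := mem_dom_mul.1 (Finset.mem_coe.1 hi)
    obtain ⟨l, hl, -⟩ := mem_dom_mul.1 (Finset.mem_coe.1 hk)
    simp only [hj, hl, Option.getD_some] at hik
    subst hik
    exact x.map.inj hj hl

/-- Green's relation `H` on a semigroup `S`: `a` and `b` generate the same principal right ideal
`a S¹ = b S¹` and the same principal left ideal `S¹ a = S¹ b`. -/
def GreenH {S : Type*} [Mul S] (a b : S) : Prop :=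
  ((a = b ∨ ∃ s, a = b * s) ∧ (a = b ∨ ∃ s, b = a * s)) ∧
    ((a = b ∨ ∃ s, a = s * b) ∧ (a = b ∨ ∃ s, b = s * a))

/-- A binary relation on `S` is a congruence. -/
def IsCongruence {S : Type*} [Mul S] (r : S → S → Prop) : Prop :=
  ∃ c : Con S, ∀ x y, c x y ↔ r x y

/-- A relation is idempotent separating if related idempotents are equal. -/
def IdempotentSeparating {S : Type*} [Mul S] (r : S → S → Prop) : Prop :=
  ∀ e f : S, IsIdempotentElem e → IsIdempotentElem f → r e f → e = f

/-- The Rees congruence `I_{m-1}^⋆` of the ideal `I_{m-1}` of the elements of rank at most `m - 1`,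
that is, of rank less than `m` (the equality relation when `m = 0`). -/
def rees (m : ℕ) (x y : PWreath G n) : Prop := (x.rank < m ∧ y.rank < m) ∨ x = y

/-- The ideal `I_m` of the elements of rank at most `m`, as a semigroup. -/
def idealI (G : Type*) [Group G] (n m : ℕ) : Subsemigroup (PWreath G n) where
  carrier := {x | x.rank ≤ m}
  mul_mem' {x y} hx _ := (rank_mul_le_left x y).trans hx

/-- The Rees congruence of the ideal `I_{m-1}` on the semigroup `I_m`. -/
def reesCon (G : Type*) [Group G] (n m : ℕ) : Con (idealI G n m) where
  r x y := rees m (x : PWreath G n) (y : PWreath G n)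
  iseqv := by
    refine ⟨fun x => Or.inr rfl, ?_, ?_⟩
    · rintro x y (⟨h, h'⟩ | h)
      · exact Or.inl ⟨h', h⟩
      · exact Or.inr h.symm
    · rintro x y z (⟨h, h'⟩ | h) (⟨k, k'⟩ | k)
      · exact Or.inl ⟨h, k'⟩
      · exact Or.inl ⟨h, k ▸ h'⟩
      · exact Or.inl ⟨h ▸ k, k'⟩
      · exact Or.inr (h.trans k)
  mul' := by
    rintro w x y z (⟨h, h'⟩ | h) (⟨k, k'⟩ | k)
    · exact Or.inl ⟨(rank_mul_le_left _ _).trans_lt h, (rank_mul_le_left _ _).trans_lt h'⟩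
    · exact Or.inl ⟨(rank_mul_le_left _ _).trans_lt h, (rank_mul_le_left _ _).trans_lt h'⟩
    · exact Or.inl ⟨(rank_mul_le_right _ _).trans_lt k, (rank_mul_le_right _ _).trans_lt k'⟩
    · refine Or.inr ?_
      change (w : PWreath G n) * y = (x : PWreath G n) * z
      rw [h, k]

/-- The principal factor `I_m / I_{m-1}`. -/
abbrev PrincipalFactor (G : Type*) [Group G] (n m : ℕ) := (reesCon G n m).Quotient

/-- The action of the symmetric group on `G^m` by permuting coordinates: `(h^a)_i = h_{ia}`.
Permutations compose from left to right, as do partial bijections, hence the opposite group. -/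
def permAct (G : Type*) [Group G] (m : ℕ) :
    (Equiv.Perm (Fin m))ᵐᵒᵖ →* MulAut (Fin m → G) where
  toFun a :=
    { toFun := fun h i => h (a.unop i)
      invFun := fun h i => h (a.unop.symm i)
      left_inv := fun h => by funext i; simp
      right_inv := fun h => by funext i; simp
      map_mul' := fun _ _ => rfl }
  map_one' := rfl
  map_mul' _ _ := rfl

/-- The wreath product `G ≀ S_m = G^m ⋊ S_m`, with `(g, a)(h, b) = (g h^a, ab)`. -/
abbrev Wreath (G : Type*) [Group G] (m : ℕ) : Type _ :=
  (Fin m → G) ⋊[permAct G m] (Equiv.Perm (Fin m))ᵐᵒᵖ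

/-- For an idempotent `e` of rank `m`, the set `L_e` of those `x = (g; a)` in the `H`-class of `e`
whose image in `G ≀ S_m` lies in `L`. This image is the element `p` whose `G^m`-part lists the
nonzero entries of `g` in increasing order of position and whose `S_m`-part is the permutation
induced by `a` on `dom e`, when `dom e` is identified with `{1, …, m}` by its increasing
enumeration. -/
def subgroupAt {m : ℕ} (L : Subgroup (Wreath G m)) (e : PWreath G n) : Set (PWreath G n) :=
  {x | GreenH x e ∧ ∃ h : e.dom.card = m, ∃ p ∈ L, ∀ k : Fin m,
    x.lab (e.dom.orderEmbOfFin h k) = ((p.left k : G) : WithZero G) ∧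
    x.map (e.dom.orderEmbOfFin h k) = some (e.dom.orderEmbOfFin h (p.right.unop k))}

/-- The relation `σ_L` on the principal factor `I_m / I_{m-1}`: `u H v` and
`u⁻¹ v ∈ L_{u⁻¹ u}`, where zero is related to itself. Nonzero elements of the principal
factor are represented by elements of rank `m`, zero by the elements of smaller rank. -/
def sigma {m : ℕ} (L : Subgroup (Wreath G m)) (u v : PrincipalFactor G n m) : Prop :=
  GreenH u v ∧ ∃ x y : idealI G n m, (x : PrincipalFactor G n m) = u ∧
    (y : PrincipalFactor G n m) = v ∧
    ((x : PWreath G n).rank < m ∨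
      (x : PWreath G n)⁻¹ * (y : PWreath G n) ∈
        subgroupAt L ((x : PWreath G n)⁻¹ * (x : PWreath G n)))

/-- The lift of a relation on the principal factor `I_m / I_{m-1}` to a relation on the set `D_m`
of elements of rank `m`. -/
def lift {m : ℕ} (s : PrincipalFactor G n m → PrincipalFactor G n m → Prop)
    (x y : PWreath G n) : Prop :=
  ∃ (hx : x.rank = m) (hy : y.rank = m),
    s ((⟨x, hx.le⟩ : idealI G n m) : PrincipalFactor G n m)
      ((⟨y, hy.le⟩ : idealI G n m) : PrincipalFactor G n m)

/-- The relation `χ(T_1, …, T_n)`: pairs `(g; a), (h; a)` such that the nonzero entries of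
`h⁻¹ g`, listed in increasing order of position, form an element of `T_i`, where `i` is the
rank of `a`. -/
def chi (T : (i : ℕ) → Subgroup (Fin i → G)) (x y : PWreath G n) : Prop :=
  x.map = y.map ∧ ∃ t ∈ T x.rank, ∀ k : Fin x.rank,
    (y.lab (x.dom.orderEmbOfFin rfl k))⁻¹ * x.lab (x.dom.orderEmbOfFin rfl k)
      = ((t k : G) : WithZero G)

/-- The projection `G^{i+1} → G^i` onto the first `i` coordinates. -/
def proj (G : Type*) [Group G] (i : ℕ) : (Fin (i + 1) → G) →* (Fin i → G) where
  toFun t k := t k.castSucc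
  map_one' := rfl
  map_mul' _ _ := rfl

/-- A subgroup of `G^i` is (permutation) invariant. -/
def PermInvariant {i : ℕ} (K : Subgroup (Fin i → G)) : Prop :=
  ∀ (s : Equiv.Perm (Fin i)) (g : Fin i → G), g ∈ K ↔ (fun k => g (s k)) ∈ K

/-- `T_{m+1}, …, T_n` is a closed family of invariant normal subgroups `T_i ⊴ G^i`, and `L` is a
normal subgroup of `G ≀ S_m` containing `(t, 1)` for all `t` in the projection of `T_{m+1}` to
`G^m` (no condition if `m = n`). The values of `T` outside `m < i ≤ n` are irrelevant. -/
structure IsDatum (n m : ℕ) (T : (i : ℕ) → Subgroup (Fin i → G))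
    (L : Subgroup (Wreath G m)) : Prop where
  normal : ∀ i, m < i → i ≤ n → (T i).Normal
  invariant : ∀ i, m < i → i ≤ n → PermInvariant (T i)
  closed : ∀ i, m < i → i + 1 ≤ n → (T (i + 1)).map (proj G i) ≤ T i
  normal_L : L.Normal
  compat : m < n → ∀ t ∈ (T (m + 1)).map (proj G m), (SemidirectProduct.inl t : Wreath G m) ∈ L

/-- The family `G, G², …, G^{m-1}, T_{m+1}π, T_{m+1}, …, T_n`, where `T_{m+1}π` is the projection
of `T_{m+1}` to `G^m`, read as the trivial subgroup of `G^m` if `m = n`. -/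
def extend (n m : ℕ) (T : (i : ℕ) → Subgroup (Fin i → G)) (i : ℕ) : Subgroup (Fin i → G) :=
  if i < m then ⊤
  else if i = m then (if i < n then (T (i + 1)).map (proj G i) else ⊥)
  else T i

/-- `ρ(m, {T_i}, L)`, the union of the Rees congruence `I_{m-1}^⋆`, the lift of `σ_L`, and
`χ(G, …, G^{m-1}, T_{m+1}π, T_{m+1}, …, T_n)`. -/
def rho (m : ℕ) (T : (i : ℕ) → Subgroup (Fin i → G)) (L : Subgroup (Wreath G m))
    (x y : PWreath G n) : Prop :=
  rees m x y ∨ lift (sigma L) x y ∨ chi (extend n m T) x y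

end PWreath

namespace PWreath

variable {G : Type*} [Group G] {n k l m : ℕ}

/-! Enumerating domain and image by `f` and `f'` identifies each `H`-class of rank `k` with `G ≀
S_k`, and products with a common middle enumeration become products in that group (`ofWreath_mul`).
Changing enumerations multiplies by permutations on both sides, which a normal subgroup does not
notice. Increasing enumerations are therefore immaterial, and every relation can be tested in any
convenient coordinates.

For (1), `ρ` is rewritten as `RankRel`: everything is related below rank `m`, a coset condition
modulo `L` holds at rank `m`, and a label condition holds above. A product either stays within its
clause or drops both elements to a lower one. Closedness of the family and the condition on `L` make
these drops consistent.

For (2), let `m` be the least rank at which `c` does not identify all elements of rank at most `m`.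
A rank `m` element related to one of smaller rank could be moved all over its `D`-class, making
everything of rank at most `m` related (`not_rank_lt_of_con`). Cutting related elements down to `m`
points therefore forces equal domains from rank `m` on (`dom_eq_of_con`), and equal partial
bijections above rank `m` (`map_eq_of_con`). What remains is a normal subgroup at rank `m` and label
subgroups above it, read off as kernels of `c` on group `H`-classes (`con_ofWreath_iff`). -/

theorem map_inj {x : PWreath G n} {i j b : Fin n} (hi : x.map i = some b) (hj : x.map j = some b) :
    i = j :=
  x.map.inj hi hj

/-! ### Coordinates for elements and their restrictions -/

/-- The element sending `f j` to `f' j` with label `g j`, undefined elsewhere. -/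
noncomputable def ofEmb (f : Fin k ↪ Fin n) (g : Fin k → G) (f' : Fin k ↪ Fin n) :
    PWreath G n where
  lab i := (Function.partialInv f i).elim 0 fun j => (g j : WithZero G)
  map :=
    { toFun := fun i => (Function.partialInv f i).map f'
      invFun := fun i => (Function.partialInv f' i).map f
      inv := by
        intro a b
        simp only [Option.map_eq_some_iff,
          f.injective.isPartialInv _ _,
          f'.injective.isPartialInv _ _]
        exact ⟨fun ⟨j, h, h'⟩ => ⟨j, h', h⟩, fun ⟨j, h, h'⟩ => ⟨j, h', h⟩⟩ }
  lab_ne_zero_iff i := by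
    change _ ↔ ((Function.partialInv f i).map f').isSome = true
    rcases Function.partialInv f i with _ | j <;> simp

/-- The restriction of `x` to the range of `f` is `ofEmb f g f'`. -/
def Agrees (x : PWreath G n) (f : Fin k ↪ Fin n) (g : Fin k → G) (f' : Fin k ↪ Fin n) : Prop :=
  ∀ j, x.lab (f j) = (g j : WithZero G) ∧ x.map (f j) = some (f' j)

theorem partialInv_apply (f : Fin k ↪ Fin n) (j : Fin k) :
    Function.partialInv f (f j) = some j :=
  (f.injective.isPartialInv _ _).2 rfl

theorem agrees_ofEmb (f : Fin k ↪ Fin n) (g : Fin k → G) (f' : Fin k ↪ Fin n) :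
    Agrees (ofEmb f g f') f g f' := by
  intro j
  constructor
  · change (Function.partialInv f (f j)).elim 0 _ = _
    rw [partialInv_apply]; rfl
  · change (Function.partialInv f (f j)).map _ = _
    rw [partialInv_apply]; rfl

theorem mem_dom_ofEmb {f : Fin k ↪ Fin n} {g : Fin k → G} {f' : Fin k ↪ Fin n} {i : Fin n} :
    i ∈ (ofEmb f g f').dom ↔ ∃ j, f j = i := by
  rw [mem_dom]
  change (∃ b, (Function.partialInv f i).map _ = some b) ↔ _
  simp only [Option.map_eq_some_iff, f.injective.isPartialInv _ _]
  exact ⟨fun ⟨_, j, h, _⟩ => ⟨j, h⟩, fun ⟨j, h⟩ => ⟨_, j, h, rfl⟩⟩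

theorem dom_ofEmb (f : Fin k ↪ Fin n) (g : Fin k → G) (f' : Fin k ↪ Fin n) :
    (ofEmb f g f').dom = Finset.univ.map f := by
  ext i; simp [mem_dom_ofEmb]

theorem rank_ofEmb (f : Fin k ↪ Fin n) (g : Fin k → G) (f' : Fin k ↪ Fin n) :
    (ofEmb f g f').rank = k := by
  simp [rank, dom_ofEmb]

theorem map_eq_none {x : PWreath G n} {i : Fin n} (h : i ∉ x.dom) : x.map i = none := by
  rcases hx : x.map i with _ | b
  · rfl
  · exact absurd (mem_dom.2 ⟨b, hx⟩) h

theorem ext_of_agrees {x y : PWreath G n} {f : Fin k ↪ Fin n} {g : Fin k → G}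
    {f' : Fin k ↪ Fin n} (hx : Agrees x f g f') (hy : Agrees y f g f')
    (hxd : ∀ i ∈ x.dom, ∃ j, f j = i) (hyd : ∀ i ∈ y.dom, ∃ j, f j = i) : x = y := by
  have key : ∀ i, x.lab i = y.lab i ∧ x.map i = y.map i := by
    intro i
    by_cases h : ∃ j, f j = i
    · obtain ⟨j, rfl⟩ := h
      exact ⟨(hx j).1.trans (hy j).1.symm, (hx j).2.trans (hy j).2.symm⟩
    · have h1 := map_eq_none fun hi => h (hxd i hi)
      have h2 := map_eq_none fun hi => h (hyd i hi)
      exact ⟨(lab_eq_zero h1).trans (lab_eq_zero h2).symm, h1.trans h2.symm⟩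
  exact PWreath.ext (funext fun i => (key i).1) (PEquiv.ext fun i => (key i).2)

theorem Agrees.eq_ofEmb {x : PWreath G n} {f : Fin k ↪ Fin n} {g : Fin k → G}
    {f' : Fin k ↪ Fin n} (hx : Agrees x f g f') (hxd : ∀ i ∈ x.dom, ∃ j, f j = i) :
    x = ofEmb f g f' :=
  ext_of_agrees hx (agrees_ofEmb _ _ _) hxd fun _ hi => mem_dom_ofEmb.1 hi

theorem Agrees.mem_dom {x : PWreath G n} {f : Fin k ↪ Fin n} {g : Fin k → G}
    {f' : Fin k ↪ Fin n} (hx : Agrees x f g f') (j : Fin k) : f j ∈ x.dom :=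
  PWreath.mem_dom.2 ⟨_, (hx j).2⟩

theorem Agrees.mul {x y : PWreath G n} {f : Fin k ↪ Fin n} {g : Fin k → G}
    {f' : Fin k ↪ Fin n} {h : Fin k → G} {f'' : Fin k ↪ Fin n} (hx : Agrees x f g f')
    (hy : Agrees y f' h f'') : Agrees (x * y) f (g * h) f'' := by
  intro j
  constructor
  · rw [mul_lab, (hx j).1, (hx j).2]
    change _ * y.lab (f' j) = _
    rw [(hy j).1]; rfl
  · rw [mul_map_apply, (hx j).2]
    exact (hy j).2

theorem ofEmb_mul {y : PWreath G n} (f : Fin k ↪ Fin n) (g : Fin k → G)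
    {f' : Fin k ↪ Fin n} {h : Fin k → G} {f'' : Fin k ↪ Fin n} (hy : Agrees y f' h f'') :
    ofEmb f g f' * y = ofEmb f (g * h) f'' := by
  refine ((agrees_ofEmb f g f').mul hy).eq_ofEmb fun i hi => ?_
  obtain ⟨b, hb, -⟩ := mem_dom_mul.1 hi
  exact mem_dom_ofEmb.1 (PWreath.mem_dom.2 ⟨b, hb⟩)

theorem Agrees.mul_ofEmb {x : PWreath G n} {f : Fin k ↪ Fin n} {g : Fin k → G}
    {f' : Fin k ↪ Fin n} (hx : Agrees x f g f') (h : Fin k → G) (f'' : Fin k ↪ Fin n) :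
    x * ofEmb f' h f'' = ofEmb f (g * h) f'' := by
  refine (hx.mul (agrees_ofEmb f' h f'')).eq_ofEmb fun i hi => ?_
  obtain ⟨b, hb, hb'⟩ := mem_dom_mul.1 hi
  obtain ⟨j, rfl⟩ := mem_dom_ofEmb.1 hb'
  exact ⟨j, map_inj (hx j).2 hb⟩

theorem exists_agrees {x : PWreath G n} {f : Fin k ↪ Fin n} (hf : ∀ j, f j ∈ x.dom) :
    ∃ (g : Fin k → G) (f' : Fin k ↪ Fin n), Agrees x f g f' := by
  choose b hb using fun j => PWreath.mem_dom.1 (hf j)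
  choose g hg using fun j => WithZero.ne_zero_iff_exists.1 (lab_ne_zero (hb j))
  refine ⟨g, ⟨b, fun i j hij => f.injective (map_inj (hb i) (hij ▸ hb j))⟩, fun j =>
    ⟨(hg j).symm, hb j⟩⟩

theorem exists_agrees_of_image {x : PWreath G n} {f' : Fin k ↪ Fin n}
    (hf : ∀ j, ∃ i, x.map i = some (f' j)) :
    ∃ (f : Fin k ↪ Fin n) (g : Fin k → G), Agrees x f g f' := by
  choose b hb using hf
  choose g hg using fun j => WithZero.ne_zero_iff_exists.1 (lab_ne_zero (hb j))
  refine ⟨⟨b, fun i j hij => f'.injective ?_⟩, g, fun j => ⟨(hg j).symm, hb j⟩⟩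
  have := hb i
  rw [hij, hb j] at this
  exact (Option.some.inj this).symm

theorem Agrees.comp {x : PWreath G n} {f : Fin k ↪ Fin n} {g : Fin k → G}
    {f' : Fin k ↪ Fin n} (hx : Agrees x f g f') (s : Fin l ↪ Fin k) :
    Agrees x (s.trans f) (g ∘ s) (s.trans f') :=
  fun j => hx (s j)

/-- An embedding whose values lie in a finset of the same size enumerates it. -/
theorem exists_apply_eq {f : Fin k ↪ Fin n} {A : Finset (Fin n)} (hf : ∀ j, f j ∈ A)
    (hA : A.card ≤ k) {i : Fin n} (hi : i ∈ A) : ∃ j, f j = i := by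
  have : Finset.univ.map f = A := by
    apply Finset.eq_of_subset_of_card_le
    · intro i hi
      obtain ⟨j, -, rfl⟩ := Finset.mem_map.1 hi
      exact hf j
    · simpa using hA
  rw [← this] at hi
  obtain ⟨j, -, rfl⟩ := Finset.mem_map.1 hi
  exact ⟨j, rfl⟩

theorem Agrees.eq_ofEmb_of_rank_le {x : PWreath G n} {f : Fin k ↪ Fin n} {g : Fin k → G}
    {f' : Fin k ↪ Fin n} (hx : Agrees x f g f') (hk : x.rank ≤ k) : x = ofEmb f g f' :=
  hx.eq_ofEmb fun _ hi => exists_apply_eq hx.mem_dom hk hi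

theorem exists_eq_ofEmb {x : PWreath G n} (hk : x.rank = k) :
    ∃ (f : Fin k ↪ Fin n) (g : Fin k → G) (f' : Fin k ↪ Fin n), x = ofEmb f g f' := by
  obtain ⟨g, f', h⟩ := exists_agrees (x := x) (f := (x.dom.orderEmbOfFin hk).toEmbedding)
    fun j => x.dom.orderEmbOfFin_mem hk j
  exact ⟨_, g, f', h.eq_ofEmb_of_rank_le hk.le⟩

theorem ofEmb_reindex (s : Equiv.Perm (Fin k)) (f : Fin k ↪ Fin n) (g : Fin k → G)
    (f' : Fin k ↪ Fin n) :
    ofEmb (s.toEmbedding.trans f) (g ∘ s) (s.toEmbedding.trans f') = ofEmb f g f' :=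
  (((agrees_ofEmb f g f').comp s.toEmbedding).eq_ofEmb_of_rank_le (rank_ofEmb _ _ _).le).symm

/-- Two embeddings with the same range differ by a permutation. -/
theorem exists_perm_trans {f f' : Fin k ↪ Fin n} (h : ∀ j, ∃ i, f i = f' j) :
    ∃ s : Equiv.Perm (Fin k), f' = s.toEmbedding.trans f := by
  choose s hs using h
  have hinj : Function.Injective s := fun i j hij => f'.injective (by rw [← hs, ← hs, hij])
  refine ⟨Equiv.ofBijective s (Finite.injective_iff_bijective.1 hinj), ?_⟩
  ext1 j
  exact (hs j).symm

/-! ### Wreath product coordinates on `H`-classes -/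

/-- The element with domain enumerated by `f` and image enumerated by `f'` given by an element of
the wreath product. -/
noncomputable def ofWreath (f f' : Fin k ↪ Fin n) (p : Wreath G k) : PWreath G n :=
  ofEmb f p.left (p.right.unop.toEmbedding.trans f')

theorem ofWreath_inl (f f' : Fin k ↪ Fin n) (g : Fin k → G) :
    ofWreath f f' (SemidirectProduct.inl g) = ofEmb f g f' := rfl

theorem rank_ofWreath (f f' : Fin k ↪ Fin n) (p : Wreath G k) : (ofWreath f f' p).rank = k :=
  rank_ofEmb _ _ _

theorem ofWreath_mul (f f' f'' : Fin k ↪ Fin n) (p q : Wreath G k) :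
    ofWreath f f' p * ofWreath f' f'' q = ofWreath f f'' (p * q) :=
  ofEmb_mul _ _ ((agrees_ofEmb f' q.left _).comp p.right.unop.toEmbedding)

theorem Agrees.mul_ofWreath {x : PWreath G n} {f : Fin k ↪ Fin n} {g : Fin k → G}
    {f' : Fin k ↪ Fin n} (hx : Agrees x f g f') (f'' : Fin k ↪ Fin n) (p : Wreath G k) :
    x * ofWreath f' f'' p = ofWreath f f'' (SemidirectProduct.inl g * p) :=
  hx.mul_ofEmb _ _

theorem ofWreath_mul_agrees {x : PWreath G n} {f' : Fin k ↪ Fin n} {g : Fin k → G}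
    {f'' : Fin k ↪ Fin n} (hx : Agrees x f' g f'') (f : Fin k ↪ Fin n) (p : Wreath G k) :
    ofWreath f f' p * x = ofWreath f f'' (p * SemidirectProduct.inl g) :=
  ofEmb_mul _ _ (hx.comp p.right.unop.toEmbedding)

theorem ofWreath_reindex (s s' : Equiv.Perm (Fin k)) (f f' : Fin k ↪ Fin n) (p : Wreath G k) :
    ofWreath (s.toEmbedding.trans f) (s'.toEmbedding.trans f') p =
      ofWreath f f' ((SemidirectProduct.inr (MulOpposite.op s))⁻¹ * p *
        SemidirectProduct.inr (MulOpposite.op s')) := by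
  -- Reindexing by `s⁻¹` restores the domain enumeration `f`; the labels and the permutation absorb
  -- `s`.
  rw [ofWreath, ← ofEmb_reindex s⁻¹, ofWreath]
  have h1 : (s⁻¹ : Equiv.Perm (Fin k)).toEmbedding.trans (s.toEmbedding.trans f) = f := by
    ext1 j; simp
  rw [h1]
  congr 1
  funext j
  rw [← map_inv]
  change p.left (s⁻¹ j) = 1 * p.left (s⁻¹ j) * 1
  rw [one_mul, mul_one]

theorem ofWreath_injective (f f' : Fin k ↪ Fin n) :
    Function.Injective (ofWreath (G := G) f f') := by
  intro p q hpq
  have hp := agrees_ofEmb f p.left (p.right.unop.toEmbedding.trans f')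
  have hq := agrees_ofEmb f q.left (q.right.unop.toEmbedding.trans f')
  have hpq : ofEmb f p.left (p.right.unop.toEmbedding.trans f') =
    ofEmb f q.left (q.right.unop.toEmbedding.trans f') := hpq
  rw [hpq] at hp
  refine SemidirectProduct.ext (funext fun j => ?_)
    (MulOpposite.unop_injective (Equiv.ext fun j => ?_))
  · exact WithZero.coe_injective ((hp j).1.symm.trans (hq j).1)
  · exact f'.injective (Option.some.inj ((hp j).2.symm.trans (hq j).2))

theorem mem_dom_ofWreath {f f' : Fin k ↪ Fin n} {p : Wreath G k} {i : Fin n} :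
    i ∈ (ofWreath f f' p).dom ↔ ∃ j, f j = i :=
  mem_dom_ofEmb

theorem ofWreath_map_eq_some {f f' : Fin k ↪ Fin n} {p : Wreath G k} {i b : Fin n}
    (h : (ofWreath f f' p).map i = some b) : ∃ j, f' j = b := by
  obtain ⟨j, rfl⟩ := mem_dom_ofWreath.1 (mem_dom.2 ⟨b, h⟩)
  have := (agrees_ofEmb f p.left (p.right.unop.toEmbedding.trans f') j).2
  exact ⟨_, Option.some.inj (this.symm.trans h)⟩

theorem exists_ofWreath_map (f f' : Fin k ↪ Fin n) (p : Wreath G k) (j : Fin k) :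
    ∃ i, (ofWreath f f' p).map i = some (f' j) := by
  refine ⟨f (p.right.unop⁻¹ j), ?_⟩
  have := (agrees_ofEmb f p.left (p.right.unop.toEmbedding.trans f') (p.right.unop⁻¹ j)).2
  exact this.trans (by simp)

/-- Enumerations of the domain and of the image of an element can be chosen freely. -/
theorem exists_ofWreath_change {f f' f₁ f₁' : Fin k ↪ Fin n} {p p₁ : Wreath G k}
    (h : ofWreath f f' p = ofWreath f₁ f₁' p₁) :
    ∃ a b : Wreath G k, ∀ q : Wreath G k, ofWreath f₁ f₁' q = ofWreath f f' (a⁻¹ * q * b) := by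
  obtain ⟨s, rfl⟩ : ∃ s : Equiv.Perm (Fin k), f₁ = s.toEmbedding.trans f :=
    exists_perm_trans fun j => by
      have : f₁ j ∈ (ofWreath f f' p).dom := h ▸ mem_dom_ofWreath.2 ⟨j, rfl⟩
      exact mem_dom_ofWreath.1 this
  obtain ⟨s', rfl⟩ : ∃ s : Equiv.Perm (Fin k), f₁' = s.toEmbedding.trans f' :=
    exists_perm_trans fun j => by
      obtain ⟨i, hi⟩ := exists_ofWreath_map (s.toEmbedding.trans f) f₁' p₁ j
      rw [← h] at hi
      exact ofWreath_map_eq_some hi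
  exact ⟨_, _, ofWreath_reindex s s' f f'⟩

/-! ### Closed families and the relation `χ` -/

/-- The subgroups `K_0, …, K_n` form a closed family of invariant normal subgroups. -/
structure IsClosedFamily (n : ℕ) (K : (i : ℕ) → Subgroup (Fin i → G)) : Prop where
  normal : ∀ i ≤ n, (K i).Normal
  invariant : ∀ i ≤ n, PermInvariant (K i)
  closed : ∀ i, i + 1 ≤ n → (K (i + 1)).map (proj G i) ≤ K i

theorem PermInvariant.map_proj {K : Subgroup (Fin (k + 1) → G)} (hK : PermInvariant K) :
    PermInvariant (K.map (proj G k)) := by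
  have key : ∀ (s : Equiv.Perm (Fin k)) (g : Fin k → G), g ∈ K.map (proj G k) →
      (fun i => g (s i)) ∈ K.map (proj G k) := by
    rintro s _ ⟨t, ht, rfl⟩
    -- Multiple transitivity extends the permutation `s` of the first `k` coordinates to all `k +
    -- 1`.
    obtain ⟨s', hs'⟩ := (Equiv.Perm.isMultiplyPretransitive (Fin (k + 1)) k).exists_smul_eq
      Fin.castSuccEmb (s.toEmbedding.trans Fin.castSuccEmb)
    refine ⟨fun i => t (s' i), (hK s' t).1 ht, funext fun i => ?_⟩
    exact congrArg t (DFunLike.congr_fun hs' i)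
  refine fun s g => ⟨key s g, fun h => ?_⟩
  simpa using key s⁻¹ _ h

theorem normal_map_proj {K : Subgroup (Fin (k + 1) → G)} (hK : K.Normal) :
    (K.map (proj G k)).Normal :=
  hK.map _ fun t => ⟨Fin.snoc t 1, funext fun i => Fin.snoc_castSucc (α := fun _ => G) 1 t i⟩

theorem permInvariant_top : PermInvariant (⊤ : Subgroup (Fin k → G)) := fun _ _ => by simp

theorem permInvariant_bot : PermInvariant (⊥ : Subgroup (Fin k → G)) := by
  intro s g
  simp only [Subgroup.mem_bot]
  refine ⟨fun h => by subst h; rfl, fun h => funext fun i => ?_⟩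
  simpa using congrFun h (s⁻¹ i)

/-- Below `m` the projection lands in the whole group. At the joint, `T_{m+1}π` makes the inclusion
an equality; if `m = n` there is no index above to check. -/
theorem IsDatum.isClosedFamily {T : (i : ℕ) → Subgroup (Fin i → G)}
    {L : Subgroup (Wreath G m)} (h : IsDatum n m T L) : IsClosedFamily n (extend n m T) where
  normal i hi := by
    unfold extend
    split_ifs with h1 h2 h3
    · infer_instance
    · exact normal_map_proj (h.normal _ (by omega) (by omega))
    · infer_instance
    · exact h.normal _ (by omega) (by omega)
  invariant i hi := by
    unfold extend
    split_ifs with h1 h2 h3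
    · exact permInvariant_top
    · exact (h.invariant _ (by omega) (by omega)).map_proj
    · exact permInvariant_bot
    · exact h.invariant _ (by omega) (by omega)
  closed i hi := by
    rcases lt_trichotomy i m with h1 | rfl | h1
    · simp [extend, h1]
    · simp [extend, Nat.lt_of_succ_le hi]
    · have e1 : extend n m T i = T i := by simp [extend, h1.ne', h1.not_gt]
      have e2 : extend n m T (i + 1) = T (i + 1) := by
        simp [extend, show ¬ i + 1 < m by omega, show i + 1 ≠ m by omega]
      rw [e1, e2]
      exact h.closed i h1 hi

theorem IsClosedFamily.comp_castLE {K : (i : ℕ) → Subgroup (Fin i → G)} (hK : IsClosedFamily n K)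
    (hkl : k ≤ l) (hl : l ≤ n) {t : Fin l → G} (ht : t ∈ K l) :
    (fun i => t (Fin.castLE hkl i)) ∈ K k := by
  induction l, hkl using Nat.le_induction with
  | base => exact ht
  | succ l hkl ih =>
    exact ih (by omega) (hK.closed l hl ⟨t, ht, rfl⟩)

/-- Invariance moves any chosen coordinates to the front, and closedness deletes the rest. -/
theorem IsClosedFamily.comp_mem {K : (i : ℕ) → Subgroup (Fin i → G)} (hK : IsClosedFamily n K)
    (hl : l ≤ n) {t : Fin l → G} (ht : t ∈ K l) (s : Fin k ↪ Fin l) :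
    (fun i => t (s i)) ∈ K k := by
  have hkl : k ≤ l := by simpa using Fintype.card_le_of_embedding s
  obtain ⟨s', hs'⟩ := (Equiv.Perm.isMultiplyPretransitive (Fin l) k).exists_smul_eq
      (Fin.castLEEmb hkl) s
  have : (fun i => t (s i)) = fun i => (fun j => t (s' j)) (Fin.castLE hkl i) :=
    funext fun i => (congrArg t (DFunLike.congr_fun hs' i)).symm
  rw [this]
  exact hK.comp_castLE hkl hl ((hK.invariant l hl s' t).1 ht)

/-- On every part of the common domain the labels of `x` and `y` differ by an element of `K`. -/
def LabelRel (K : (i : ℕ) → Subgroup (Fin i → G)) (x y : PWreath G n) : Prop :=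
  x.map = y.map ∧ ∀ (r : ℕ) (f : Fin r ↪ Fin n), (∀ j, f j ∈ x.dom) →
    ∃ t ∈ K r, ∀ j, x.lab (f j) = y.lab (f j) * (t j : WithZero G)

theorem dom_eq_of_map_eq {x y : PWreath G n} (h : x.map = y.map) : x.dom = y.dom := by
  simp [dom, h]

theorem rank_eq_of_map_eq {x y : PWreath G n} (h : x.map = y.map) : x.rank = y.rank := by
  rw [rank, rank, dom_eq_of_map_eq h]

theorem lab_ne_zero_of_mem_dom {x : PWreath G n} {i : Fin n} (h : i ∈ x.dom) : x.lab i ≠ 0 := by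
  obtain ⟨j, hj⟩ := mem_dom.1 h
  exact lab_ne_zero hj

theorem rank_le (x : PWreath G n) : x.rank ≤ n := by
  simpa [rank] using Finset.card_le_univ x.dom

/-- The increasing enumeration of the domain is one instance of `LabelRel`; by `comp_mem` it implies
all the others. Quantifying over all embeddings removes the order and makes the relation stable
under restriction. -/
theorem IsClosedFamily.chi_iff {K : (i : ℕ) → Subgroup (Fin i → G)} (hK : IsClosedFamily n K)
    {x y : PWreath G n} : chi K x y ↔ LabelRel K x y := by
  refine and_congr_right fun hmap => ?_
  have hne : ∀ i ∈ x.dom, y.lab i ≠ 0 := fun i hi =>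
    lab_ne_zero_of_mem_dom (dom_eq_of_map_eq hmap ▸ hi)
  constructor
  · rintro ⟨t, ht, h⟩ r f hf
    have : ∀ j, ∃ i, x.dom.orderEmbOfFin rfl i = f j := fun j =>
      exists_apply_eq (f := (x.dom.orderEmbOfFin rfl).toEmbedding)
        (fun i => x.dom.orderEmbOfFin_mem rfl i) le_rfl (hf j)
    choose s hs using this
    refine ⟨_, hK.comp_mem (rank_le x) ht ⟨s, fun i j hij => f.injective ?_⟩, fun j => ?_⟩
    · rw [← hs, ← hs, hij]
    · rw [← inv_mul_eq_iff_eq_mul₀ (hne _ (hf j)), ← hs]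
      exact h (s j)
  · intro h
    obtain ⟨t, ht, h'⟩ := h _ (x.dom.orderEmbOfFin rfl).toEmbedding
      fun i => x.dom.orderEmbOfFin_mem rfl i
    exact ⟨t, ht, fun j =>
      (inv_mul_eq_iff_eq_mul₀ (hne _ (x.dom.orderEmbOfFin_mem rfl j))).2 (h' j)⟩

theorem LabelRel.refl (K : (i : ℕ) → Subgroup (Fin i → G)) (x : PWreath G n) : LabelRel K x x :=
  ⟨rfl, fun _ _ _ => ⟨1, one_mem _, fun _ => by simp⟩⟩

theorem LabelRel.symm {K : (i : ℕ) → Subgroup (Fin i → G)} {x y : PWreath G n}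
    (h : LabelRel K x y) : LabelRel K y x := by
  refine ⟨h.1.symm, fun r f hf => ?_⟩
  obtain ⟨t, ht, h'⟩ := h.2 r f (dom_eq_of_map_eq h.1 ▸ hf)
  exact ⟨t⁻¹, inv_mem ht, fun j => by simp [h' j]⟩

theorem LabelRel.trans {K : (i : ℕ) → Subgroup (Fin i → G)} {x y z : PWreath G n}
    (h : LabelRel K x y) (h₁ : LabelRel K y z) : LabelRel K x z := by
  refine ⟨h.1.trans h₁.1, fun r f hf => ?_⟩
  obtain ⟨t, ht, h'⟩ := h.2 r f hf
  obtain ⟨t₁, ht₁, h₁'⟩ := h₁.2 r f (dom_eq_of_map_eq h.1 ▸ hf)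
  exact ⟨t₁ * t, mul_mem ht₁ ht, fun j => by simp [h' j, h₁' j, mul_assoc]⟩

theorem LabelRel.mul_left {K : (i : ℕ) → Subgroup (Fin i → G)} {x y : PWreath G n}
    (h : LabelRel K x y) (z : PWreath G n) : LabelRel K (z * x) (z * y) := by
  refine ⟨by rw [mul_map, mul_map, h.1], fun r f hf => ?_⟩
  have hf' : ∀ j, ∃ b, z.map (f j) = some b ∧ b ∈ x.dom := fun j => mem_dom_mul.1 (hf j)
  choose b hb hbx using hf'
  obtain ⟨t, ht, h'⟩ := h.2 r
    ⟨b, fun i j hij => f.injective (map_inj (hb i) (hij ▸ hb j))⟩ hbx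
  refine ⟨t, ht, fun j => ?_⟩
  rw [mul_lab, mul_lab, hb]
  change _ * x.lab (b j) = _ * y.lab (b j) * _
  rw [mul_assoc]
  exact congrArg _ (h' j)

theorem LabelRel.mul_right {K : (i : ℕ) → Subgroup (Fin i → G)} (hK : IsClosedFamily n K)
    {x y : PWreath G n} (h : LabelRel K x y) (z : PWreath G n) :
    LabelRel K (x * z) (y * z) := by
  refine ⟨by rw [mul_map, mul_map, h.1], fun r f hf => ?_⟩
  have hf' : ∀ j, ∃ b, x.map (f j) = some b ∧ b ∈ z.dom := fun j => mem_dom_mul.1 (hf j)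
  choose b hb hbz using hf'
  obtain ⟨t, ht, h'⟩ := h.2 r f fun j => mem_dom.2 ⟨_, hb j⟩
  choose g hg using fun j => WithZero.ne_zero_iff_exists.1 (lab_ne_zero_of_mem_dom (hbz j))
  have hr : r ≤ n := by simpa using Fintype.card_le_of_embedding f
  -- The labels of `z` are multiplied in to the right of `t`, so `t` gets conjugated; this is where
  -- normality enters.
  refine ⟨g⁻¹ * t * g, by simpa using (hK.normal r hr).conj_mem t ht g⁻¹, fun j => ?_⟩
  rw [mul_lab, mul_lab, ← h.1, hb]
  change _ * z.lab (b j) = _ * z.lab (b j) * _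
  rw [h' j, ← hg j]
  have : (g j : WithZero G) ≠ 0 := WithZero.coe_ne_zero
  simp [mul_assoc, this]

theorem IsClosedFamily.isCongruence_chi {K : (i : ℕ) → Subgroup (Fin i → G)}
    (hK : IsClosedFamily n K) : IsCongruence (chi (n := n) K) :=
  ⟨{ r := LabelRel K
     iseqv := ⟨LabelRel.refl K, LabelRel.symm, LabelRel.trans⟩
     mul' := fun {_ x y _} h h' => (h.mul_right hK y).trans (h'.mul_left x) },
    fun _ _ => hK.chi_iff.symm⟩

theorem map_of_isIdempotentElem {e : PWreath G n} (he : IsIdempotentElem e) {i j : Fin n}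
    (h : e.map i = some j) : j = i := by
  have h1 : (e * e).map i = some j := by rw [he.eq, h]
  rw [mul_map_apply, h] at h1
  exact map_inj h1 h

theorem lab_of_isIdempotentElem {e : PWreath G n} (he : IsIdempotentElem e) {i : Fin n}
    (h : i ∈ e.dom) : e.lab i = 1 := by
  obtain ⟨j, hj⟩ := mem_dom.1 h
  obtain rfl := map_of_isIdempotentElem he hj
  have h1 : (e * e).lab j = e.lab j := by rw [he.eq]
  rw [mul_lab, hj] at h1
  exact (mul_eq_left₀ (lab_ne_zero hj)).1 h1

/-- An idempotent has label `1` throughout its domain, so its partial bijection determines it. -/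
theorem idempotentSeparating_chi (K : (i : ℕ) → Subgroup (Fin i → G)) :
    IdempotentSeparating (chi (n := n) K) := by
  rintro e f he hf ⟨h, -⟩
  refine PWreath.ext (funext fun i => ?_) h
  by_cases hi : i ∈ e.dom
  · rw [lab_of_isIdempotentElem he hi, lab_of_isIdempotentElem hf (dom_eq_of_map_eq h ▸ hi)]
  · rw [lab_eq_zero (map_eq_none hi), lab_eq_zero (map_eq_none (dom_eq_of_map_eq h ▸ hi))]

theorem isCongruence_rees (m : ℕ) : IsCongruence (rees (G := G) (n := n) m) := by
  refine ⟨⟨⟨rees m, fun x => Or.inr rfl, ?_, ?_⟩, ?_⟩, fun _ _ => Iff.rfl⟩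
  · rintro x y (⟨h, h'⟩ | h)
    · exact Or.inl ⟨h', h⟩
    · exact Or.inr h.symm
  · rintro x y z (⟨h, h'⟩ | h) (⟨k, k'⟩ | k)
    · exact Or.inl ⟨h, k'⟩
    · exact Or.inl ⟨h, k ▸ h'⟩
    · exact Or.inl ⟨h ▸ k, k'⟩
    · exact Or.inr (h.trans k)
  · rintro w x y z (⟨h, h'⟩ | h) (⟨k, k'⟩ | k)
    · exact Or.inl ⟨(rank_mul_le_left _ _).trans_lt h, (rank_mul_le_left _ _).trans_lt h'⟩
    · exact Or.inl ⟨(rank_mul_le_left _ _).trans_lt h, (rank_mul_le_left _ _).trans_lt h'⟩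
    · exact Or.inl ⟨(rank_mul_le_right _ _).trans_lt k, (rank_mul_le_right _ _).trans_lt k'⟩
    · exact Or.inr (by rw [h, k])

/-! ### Cosets of `L` at rank `m` -/

theorem exists_eq_ofWreath {x : PWreath G n} (hk : x.rank = k) :
    ∃ (f f' : Fin k ↪ Fin n) (p : Wreath G k), x = ofWreath f f' p := by
  obtain ⟨f, g, f', rfl⟩ := exists_eq_ofEmb hk
  exact ⟨f, f', _, (ofWreath_inl f f' g).symm⟩

/-- `x` and `y` have rank `m`, the same domain and image, and differ by an element of `L`. -/
def WreathRel (L : Subgroup (Wreath G m)) (x y : PWreath G n) : Prop :=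
  ∃ (f f' : Fin m ↪ Fin n) (p q : Wreath G m), p⁻¹ * q ∈ L ∧
    x = ofWreath f f' p ∧ y = ofWreath f f' q

theorem conj_mem_iff {L : Subgroup (Wreath G m)} (hL : L.Normal) (a b p q : Wreath G m) :
    (a * p * b)⁻¹ * (a * q * b) ∈ L ↔ p⁻¹ * q ∈ L := by
  rw [show (a * p * b)⁻¹ * (a * q * b) = b⁻¹ * (p⁻¹ * q) * b⁻¹⁻¹ by group]
  exact ⟨fun h => by simpa [mul_assoc] using hL.conj_mem _ h b, fun h => hL.conj_mem _ h _⟩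

/-- Other coordinates for the same element change `p⁻¹ * q` only by conjugation, so they may be
fixed in advance. -/
theorem wreathRel_iff {L : Subgroup (Wreath G m)} (hL : L.Normal) (f f' : Fin m ↪ Fin n)
    (p : Wreath G m) (y : PWreath G n) :
    WreathRel L (ofWreath f f' p) y ↔ ∃ q, p⁻¹ * q ∈ L ∧ y = ofWreath f f' q := by
  constructor
  · rintro ⟨f₁, f₁', p₁, q₁, h, hx, rfl⟩
    obtain ⟨a, b, hab⟩ := exists_ofWreath_change hx
    rw [hab] at hx
    obtain rfl := ofWreath_injective _ _ hx
    exact ⟨a⁻¹ * q₁ * b, (conj_mem_iff hL _ _ _ _).2 h, hab q₁⟩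
  · rintro ⟨q, h, rfl⟩
    exact ⟨f, f', p, q, h, rfl, rfl⟩

theorem wreathRel_ofWreath {L : Subgroup (Wreath G m)} (hL : L.Normal) (f f' : Fin m ↪ Fin n)
    (p q : Wreath G m) :
    WreathRel L (ofWreath f f' p) (ofWreath f f' q) ↔ p⁻¹ * q ∈ L := by
  rw [wreathRel_iff hL]
  refine ⟨?_, fun h => ⟨q, h, rfl⟩⟩
  rintro ⟨q', h, hq⟩
  rwa [ofWreath_injective _ _ hq]

theorem WreathRel.rank_left {L : Subgroup (Wreath G m)} {x y : PWreath G n}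
    (h : WreathRel L x y) : x.rank = m := by
  obtain ⟨f, f', p, q, -, rfl, -⟩ := h
  exact rank_ofWreath _ _ _

theorem WreathRel.symm {L : Subgroup (Wreath G m)} {x y : PWreath G n}
    (h : WreathRel L x y) : WreathRel L y x := by
  obtain ⟨f, f', p, q, h, hx, hy⟩ := h
  exact ⟨f, f', q, p, by simpa using inv_mem h, hy, hx⟩

theorem WreathRel.rank_right {L : Subgroup (Wreath G m)} {x y : PWreath G n}
    (h : WreathRel L x y) : y.rank = m :=
  h.symm.rank_left

theorem WreathRel.refl (L : Subgroup (Wreath G m)) {x : PWreath G n} (hx : x.rank = m) :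
    WreathRel L x x := by
  obtain ⟨f, f', p, rfl⟩ := exists_eq_ofWreath hx
  exact ⟨f, f', p, p, by simp, rfl, rfl⟩

theorem WreathRel.trans {L : Subgroup (Wreath G m)} (hL : L.Normal) {x y z : PWreath G n}
    (h : WreathRel L x y) (h' : WreathRel L y z) : WreathRel L x z := by
  obtain ⟨f, f', p, q, h, rfl, rfl⟩ := h
  obtain ⟨r, hr, rfl⟩ := (wreathRel_iff hL _ _ _ _).1 h'
  exact ⟨f, f', p, r, by simpa [mul_assoc] using mul_mem h hr, rfl, rfl⟩

/-- Multiplying on the right by an element undefined at some point of the image lowers the rank. -/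
theorem rank_ofWreath_mul_lt {f f' : Fin k ↪ Fin n} {z : PWreath G n} {j : Fin k}
    (hj : f' j ∉ z.dom) (p : Wreath G k) : (ofWreath f f' p * z).rank < k := by
  obtain ⟨i, hi⟩ := exists_ofWreath_map f f' p j
  conv_rhs => rw [← rank_ofWreath f f' p]
  apply Finset.card_lt_card
  refine (Finset.ssubset_iff_of_subset fun a ha => ?_).2 ⟨i, mem_dom.2 ⟨_, hi⟩, fun h => ?_⟩
  · obtain ⟨b, hb, -⟩ := mem_dom_mul.1 ha
    exact mem_dom.2 ⟨b, hb⟩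
  · obtain ⟨b, hb, hb'⟩ := mem_dom_mul.1 h
    rw [hi] at hb
    exact hj (Option.some.inj hb ▸ hb')

/-- Multiplying on the left by an element whose image misses a point of the domain lowers the
rank. -/
theorem rank_mul_ofWreath_lt {f f' : Fin k ↪ Fin n} {z : PWreath G n} {j : Fin k}
    (hj : ∀ i, z.map i ≠ some (f j)) (p : Wreath G k) : (z * ofWreath f f' p).rank < k := by
  by_contra hc
  have hr : (z * ofWreath f f' p).rank = k :=
    le_antisymm ((rank_mul_le_right _ _).trans (rank_ofWreath _ _ _).le) (not_lt.1 hc)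
  have hd : ∀ i, (z * ofWreath f f' p).dom.orderEmbOfFin hr i ∈ (z * ofWreath f f' p).dom :=
    fun i => Finset.orderEmbOfFin_mem _ hr i
  choose b hb hb' using fun i => mem_dom_mul.1 (hd i)
  -- If the rank did not drop, `z` would send the domain of the product injectively onto all `k`
  -- points of the right factor's domain, including `f j`.
  let F : Fin k ↪ Fin n := ⟨b, fun i i' h => ((z * ofWreath f f' p).dom.orderEmbOfFin hr).injective
    (map_inj (hb i) (h ▸ hb i'))⟩
  obtain ⟨i, hi⟩ := exists_apply_eq (f := F) (A := (ofWreath f f' p).dom) hb'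
    (rank_ofWreath f f' p).le (mem_dom_ofWreath.2 ⟨j, rfl⟩)
  have hi : b i = f j := hi
  exact hj _ (hi ▸ hb i)

/-- The two elements share their image, so `z` is defined on all of it, acting as a right
translation in `G ≀ S_m`, or lowers both ranks. -/
theorem WreathRel.mul_right {L : Subgroup (Wreath G m)} (hL : L.Normal) {x y : PWreath G n}
    (h : WreathRel L x y) (z : PWreath G n) :
    WreathRel L (x * z) (y * z) ∨ (x * z).rank < m ∧ (y * z).rank < m := by
  obtain ⟨f, f', p, q, h, rfl, rfl⟩ := h
  by_cases hz : ∀ j, f' j ∈ z.dom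
  · obtain ⟨g, f'', hg⟩ := exists_agrees hz
    left
    rw [ofWreath_mul_agrees hg, ofWreath_mul_agrees hg, wreathRel_ofWreath hL]
    have := conj_mem_iff hL 1 (SemidirectProduct.inl g) p q
    rw [one_mul, one_mul] at this
    exact this.2 h
  · push Not at hz
    obtain ⟨j, hj⟩ := hz
    exact Or.inr ⟨rank_ofWreath_mul_lt hj p, rank_ofWreath_mul_lt hj q⟩

theorem WreathRel.mul_left {L : Subgroup (Wreath G m)} (hL : L.Normal) {x y : PWreath G n}
    (h : WreathRel L x y) (z : PWreath G n) :
    WreathRel L (z * x) (z * y) ∨ (z * x).rank < m ∧ (z * y).rank < m := by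
  obtain ⟨f, f', p, q, h, rfl, rfl⟩ := h
  by_cases hz : ∀ j, ∃ i, z.map i = some (f j)
  · obtain ⟨f'', g, hg⟩ := exists_agrees_of_image hz
    left
    rw [hg.mul_ofWreath, hg.mul_ofWreath, wreathRel_ofWreath hL]
    have := conj_mem_iff hL (SemidirectProduct.inl g) 1 p q
    rw [mul_one, mul_one] at this
    exact this.2 h
  · push Not at hz
    obtain ⟨j, hj⟩ := hz
    exact Or.inr ⟨rank_mul_ofWreath_lt hj p, rank_mul_ofWreath_lt hj q⟩

/-! ### The union as a congruence -/

/-- The relation `ρ`, split according to the rank. -/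
def RankRel (m : ℕ) (K : (i : ℕ) → Subgroup (Fin i → G)) (L : Subgroup (Wreath G m))
    (x y : PWreath G n) : Prop :=
  (x.rank < m ∧ y.rank < m) ∨ WreathRel L x y ∨ (m < x.rank ∧ LabelRel K x y)

theorem LabelRel.wreathRel {K : (i : ℕ) → Subgroup (Fin i → G)} {L : Subgroup (Wreath G m)}
    (hL : L.Normal) (hKL : ∀ t ∈ K m, (SemidirectProduct.inl t : Wreath G m) ∈ L)
    {x y : PWreath G n} (hx : x.rank = m) (h : LabelRel K x y) : WreathRel L x y := by
  have hy : y.rank = m := (rank_eq_of_map_eq h.1).symm.trans hx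
  obtain ⟨f, g, f', rfl⟩ := exists_eq_ofEmb hy
  have hd := dom_eq_of_map_eq h.1
  obtain ⟨t, ht, h'⟩ := h.2 m f fun j => hd ▸ mem_dom_ofEmb.2 ⟨j, rfl⟩
  have hxe : x = ofEmb f (g * t) f' := by
    refine Agrees.eq_ofEmb_of_rank_le (fun j => ⟨?_, ?_⟩) hx.le
    · rw [h' j, (agrees_ofEmb f g f' j).1]; rfl
    · rw [h.1, (agrees_ofEmb f g f' j).2]
  subst hxe
  refine WreathRel.symm ?_
  rw [← ofWreath_inl, ← ofWreath_inl, wreathRel_ofWreath hL, map_mul, inv_mul_cancel_left]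
  exact hKL t ht

/-- Multiplying a pair of rank above `m` may lower its rank arbitrarily; this puts the product into
the right clause. -/
theorem LabelRel.rankRel {K : (i : ℕ) → Subgroup (Fin i → G)} {L : Subgroup (Wreath G m)}
    (hL : L.Normal) (hKL : ∀ t ∈ K m, (SemidirectProduct.inl t : Wreath G m) ∈ L)
    {x y : PWreath G n} (h : LabelRel K x y) : RankRel m K L x y := by
  rcases lt_trichotomy x.rank m with hx | hx | hx
  · exact Or.inl ⟨hx, rank_eq_of_map_eq h.1 ▸ hx⟩
  · exact Or.inr (Or.inl (h.wreathRel hL hKL hx))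
  · exact Or.inr (Or.inr ⟨hx, h⟩)

theorem RankRel.trans {K : (i : ℕ) → Subgroup (Fin i → G)} {L : Subgroup (Wreath G m)}
    (hL : L.Normal) {x y z : PWreath G n} (h₁ : RankRel m K L x y) (h₂ : RankRel m K L y z) :
    RankRel m K L x z := by
  rcases h₁ with ⟨h, h'⟩ | h | ⟨h, h'⟩ <;> rcases h₂ with ⟨k, k'⟩ | k | ⟨k, k'⟩
  · exact Or.inl ⟨h, k'⟩
  · exact absurd k.rank_left h'.ne
  · exact absurd h' k.not_gt
  · exact absurd h.rank_right k.ne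
  · exact Or.inr (Or.inl (h.trans hL k))
  · exact absurd h.rank_right k.ne'
  · exact absurd k (rank_eq_of_map_eq h'.1 ▸ h).not_gt
  · exact absurd k.rank_left (rank_eq_of_map_eq h'.1 ▸ h).ne'
  · exact Or.inr (Or.inr ⟨h, h'.trans k'⟩)

/-- `RankRel` as a congruence. -/
def rankCon {K : (i : ℕ) → Subgroup (Fin i → G)} (hK : IsClosedFamily n K)
    {L : Subgroup (Wreath G m)} (hL : L.Normal)
    (hKL : ∀ t ∈ K m, (SemidirectProduct.inl t : Wreath G m) ∈ L) : Con (PWreath G n) where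
  r := RankRel m K L
  iseqv := by
    refine ⟨fun x => (LabelRel.refl K x).rankRel hL hKL, ?_, ?_⟩
    · rintro x y (⟨h, h'⟩ | h | ⟨h, h'⟩)
      · exact Or.inl ⟨h', h⟩
      · exact Or.inr (Or.inl h.symm)
      · exact Or.inr (Or.inr ⟨rank_eq_of_map_eq h'.1 ▸ h, h'.symm⟩)
    · exact fun h h' => h.trans hL h'
  mul' := by
    have hl : ∀ z x y : PWreath G n, RankRel m K L x y → RankRel m K L (z * x) (z * y) := by
      rintro z x y (⟨h, h'⟩ | h | ⟨-, h⟩)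
      · exact Or.inl ⟨(rank_mul_le_right _ _).trans_lt h, (rank_mul_le_right _ _).trans_lt h'⟩
      · rcases h.mul_left hL z with h | h
        · exact Or.inr (Or.inl h)
        · exact Or.inl h
      · exact (h.mul_left z).rankRel hL hKL
    have hr : ∀ z x y : PWreath G n, RankRel m K L x y → RankRel m K L (x * z) (y * z) := by
      rintro z x y (⟨h, h'⟩ | h | ⟨-, h⟩)
      · exact Or.inl ⟨(rank_mul_le_left _ _).trans_lt h, (rank_mul_le_left _ _).trans_lt h'⟩
      · rcases h.mul_right hL z with h | h
        · exact Or.inr (Or.inl h)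
        · exact Or.inl h
      · exact (h.mul_right hK z).rankRel hL hKL
    exact fun {_ x y _} h h' => (hr y _ _ h).trans hL (hl x _ _ h')

/-! ### Green's relation and the principal factor -/

theorem greenH_ofWreath (f f' : Fin k ↪ Fin n) (p q : Wreath G k) :
    GreenH (ofWreath f f' p) (ofWreath f f' q) := by
  refine ⟨⟨Or.inr ⟨ofWreath f' f' (q⁻¹ * p), ?_⟩, Or.inr ⟨ofWreath f' f' (p⁻¹ * q), ?_⟩⟩,
    Or.inr ⟨ofWreath f f (p * q⁻¹), ?_⟩, Or.inr ⟨ofWreath f f (q * p⁻¹), ?_⟩⟩ <;>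
  simp [ofWreath_mul]

theorem inv_ofEmb (f f' : Fin k ↪ Fin n) (g : Fin k → G) :
    (ofEmb f g f')⁻¹ = ofWreath f' f (SemidirectProduct.inl g)⁻¹ := by
  rw [← map_inv, ofWreath_inl]
  have hs : ∀ j, (ofEmb f g f').map.symm (f' j) = some (f j) := fun j =>
    (PEquiv.eq_some_iff (ofEmb f g f').map).2 (agrees_ofEmb f g f' j).2
  refine Agrees.eq_ofEmb (fun j => ⟨?_, hs j⟩) fun i hi => ?_
  · change ((ofEmb f g f').map.symm (f' j)).elim 0 (fun i => ((ofEmb f g f').lab i)⁻¹) = _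
    rw [hs]
    change ((ofEmb f g f').lab (f j))⁻¹ = _
    rw [(agrees_ofEmb f g f' j).1]; rfl
  · obtain ⟨b, hb⟩ := mem_dom.1 hi
    have hb : (ofEmb f g f').map b = some i := (PEquiv.eq_some_iff (ofEmb f g f').map).1 hb
    rw [← ofWreath_inl] at hb
    exact ofWreath_map_eq_some hb

theorem inv_mul_ofWreath (f f' : Fin k ↪ Fin n) (g : Fin k → G) (q : Wreath G k) :
    (ofEmb f g f')⁻¹ * ofWreath f f' q = ofWreath f' f' ((SemidirectProduct.inl g)⁻¹ * q) := by
  rw [inv_ofEmb, ofWreath_mul]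

theorem inv_mul_ofEmb (f f' : Fin k ↪ Fin n) (g : Fin k → G) :
    (ofEmb f g f')⁻¹ * ofEmb f g f' = ofWreath f' f' 1 := by
  have := inv_mul_ofWreath f f' g (SemidirectProduct.inl g)
  rwa [inv_mul_cancel, ofWreath_inl] at this

theorem ofEmb_mul_inv_mul (f f' : Fin k ↪ Fin n) (g : Fin k → G) :
    ofEmb f g f' * ((ofEmb f g f')⁻¹ * ofEmb f g f') = ofEmb f g f' := by
  rw [inv_mul_ofEmb, ← ofWreath_inl, ofWreath_mul, mul_one]

theorem mem_subgroupAt {L : Subgroup (Wreath G m)} (hL : L.Normal) (f : Fin m ↪ Fin n)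
    (z : PWreath G n) :
    z ∈ subgroupAt L (ofWreath f f 1) ↔ ∃ p ∈ L, z = ofWreath f f p := by
  have hr : (ofWreath f f (1 : Wreath G m)).dom.card = m := rank_ofWreath f f 1
  obtain ⟨s, hs⟩ : ∃ s : Equiv.Perm (Fin m),
      ((ofWreath f f (1 : Wreath G m)).dom.orderEmbOfFin hr).toEmbedding =
        s.toEmbedding.trans f :=
    exists_perm_trans fun j => mem_dom_ofWreath.1 (Finset.orderEmbOfFin_mem _ hr j)
  constructor
  · rintro ⟨hg, _, p, hp, hz⟩
    have hz' : Agrees z ((ofWreath f f (1 : Wreath G m)).dom.orderEmbOfFin hr).toEmbedding p.left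
      (p.right.unop.toEmbedding.trans
        ((ofWreath f f (1 : Wreath G m)).dom.orderEmbOfFin hr).toEmbedding) := hz
    -- The coordinate conditions see `z` only on the domain of the idempotent; `H` excludes further
    -- points.
    have hzr : z.rank ≤ m := by
      rw [← rank_ofWreath f f (1 : Wreath G m)]
      rcases hg.1.1 with rfl | ⟨s, rfl⟩
      · exact le_rfl
      · exact rank_mul_le_left _ _
    rw [hs] at hz'
    refine ⟨_, ?_, (hz'.eq_ofEmb_of_rank_le hzr).trans (ofWreath_reindex s s f f p)⟩
    simpa using hL.conj_mem p hp (SemidirectProduct.inr (MulOpposite.op s))⁻¹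
  · rintro ⟨p, hp, rfl⟩
    let a : Wreath G m := SemidirectProduct.inr (MulOpposite.op s)
    refine ⟨greenH_ofWreath _ _ _ _, hr, a * p * a⁻¹, hL.conj_mem p hp a, ?_⟩
    have : ofWreath f f p = ofWreath
        ((ofWreath f f (1 : Wreath G m)).dom.orderEmbOfFin hr).toEmbedding
        ((ofWreath f f (1 : Wreath G m)).dom.orderEmbOfFin hr).toEmbedding (a * p * a⁻¹) := by
      rw [hs, ofWreath_reindex]
      congr 1
      change p = a⁻¹ * (a * p * a⁻¹) * a
      group
    intro j
    conv_lhs => rw [this]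
    conv in (ofWreath f f p).map => rw [this]
    exact agrees_ofEmb _ _ _ j

theorem coe_eq_coe_iff {x y : idealI G n m} :
    (x : PrincipalFactor G n m) = y ↔ rees m (x : PWreath G n) (y : PWreath G n) :=
  (reesCon G n m).eq

theorem eq_of_rees {x y : PWreath G n} (h : rees m x y) (hx : ¬ x.rank < m) : x = y :=
  h.resolve_left fun h => hx h.1

theorem sigma_coe_iff {L : Subgroup (Wreath G m)} (hL : L.Normal) (x y : idealI G n m) :
    sigma L (x : PrincipalFactor G n m) (y : PrincipalFactor G n m) ↔
      ((x : PWreath G n).rank < m ∧ (y : PWreath G n).rank < m) ∨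
        WreathRel L (x : PWreath G n) (y : PWreath G n) := by
  constructor
  · rintro ⟨hg, x', y', hx', hy', h⟩
    -- Only the right ideal half of `H` is needed. Taking `s` in the full monoid lets `s = 1` cover
    -- the case of equality.
    have hx : ∃ s : PWreath G n, rees m (y : PWreath G n) (x * s) := by
      rcases hg.1.2 with h | ⟨s, h⟩
      · exact ⟨1, by simpa using coe_eq_coe_iff.1 h.symm⟩
      · induction s using Con.induction_on with | _ s => exact ⟨s, coe_eq_coe_iff.1 h⟩
    have hy : ∃ s : PWreath G n, rees m (x : PWreath G n) (y * s) := by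
      rcases hg.1.1 with h | ⟨s, h⟩
      · exact ⟨1, by simpa using coe_eq_coe_iff.1 h⟩
      · induction s using Con.induction_on with | _ s => exact ⟨s, coe_eq_coe_iff.1 h⟩
    have hlt : (x : PWreath G n).rank < m ↔ (y : PWreath G n).rank < m := by
      have : ∀ (x y s : PWreath G n), rees m y (x * s) → x.rank < m → y.rank < m := by
        rintro x y s (⟨h, -⟩ | rfl) hx
        · exact h
        · exact (rank_mul_le_left _ _).trans_lt hx
      obtain ⟨s, hs⟩ := hx
      obtain ⟨t, ht⟩ := hy
      exact ⟨this _ _ _ hs, this _ _ _ ht⟩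
    by_cases hxm : (x : PWreath G n).rank < m
    · exact Or.inl ⟨hxm, hlt.1 hxm⟩
    have hym := mt hlt.2 hxm
    right
    have hxx := eq_of_rees (coe_eq_coe_iff.1 hx'.symm) hxm
    have hyy := eq_of_rees (coe_eq_coe_iff.1 hy'.symm) hym
    obtain ⟨s, hs⟩ := hx
    have hs := eq_of_rees hs hym
    rw [← hxx, ← hyy] at h
    have h := h.resolve_left hxm
    obtain ⟨f, g, f', hx⟩ := exists_eq_ofEmb (le_antisymm x.2 (not_lt.1 hxm))
    rw [hx] at hs h ⊢
    rw [inv_mul_ofEmb] at h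
    obtain ⟨p, hp, h⟩ := (mem_subgroupAt hL _ _).1 h
    refine ⟨f, f', SemidirectProduct.inl g, SemidirectProduct.inl g * p, by simpa using hp,
      rfl, ?_⟩
    -- Since `y = x * s`, also `x * (x⁻¹ * y) = y`, so `x⁻¹ * y` determines `y`.
    rw [← ofWreath_mul f f' f', ← h, ofWreath_inl, hs, ← mul_assoc, ← mul_assoc,
      mul_assoc (ofEmb f g f'), ofEmb_mul_inv_mul]
  · rintro (⟨hx, hy⟩ | h)
    · have hxy : (x : PrincipalFactor G n m) = y := coe_eq_coe_iff.2 (Or.inl ⟨hx, hy⟩)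
      exact ⟨⟨⟨Or.inl hxy, Or.inl hxy⟩, Or.inl hxy, Or.inl hxy⟩, x, y, rfl, rfl, Or.inl hx⟩
    · obtain ⟨x, hxm⟩ := x
      obtain ⟨y, hym⟩ := y
      dsimp only at h
      obtain ⟨f, g, f', rfl⟩ := exists_eq_ofEmb h.rank_left
      rw [← ofWreath_inl] at h
      obtain ⟨q, hq, rfl⟩ := (wreathRel_iff hL _ _ _ _).1 h
      refine ⟨?_, _, _, rfl, rfl, Or.inr ?_⟩
      · let w (f f' : Fin m ↪ Fin n) (p : Wreath G m) : idealI G n m :=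
          ⟨ofWreath f f' p, (rank_ofWreath f f' p).le⟩
        have hw : ∀ f f' f'' p q, (w f f'' (p * q) : PrincipalFactor G n m) =
            w f f' p * w f' f'' q := fun f f' f'' p q =>
          congrArg ((↑) : idealI G n m → PrincipalFactor G n m)
            (Subtype.ext (ofWreath_mul f f' f'' p q).symm)
        let p : Wreath G m := SemidirectProduct.inl g
        change GreenH (w f f' p : PrincipalFactor G n m) (w f f' q)
        refine ⟨⟨Or.inr ⟨w f' f' (q⁻¹ * p), ?_⟩, Or.inr ⟨w f' f' (p⁻¹ * q), ?_⟩⟩,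
          Or.inr ⟨w f f (p * q⁻¹), ?_⟩, Or.inr ⟨w f f (q * p⁻¹), ?_⟩⟩ <;>
        simp [← hw]
      · dsimp only
        rw [inv_mul_ofEmb, inv_mul_ofWreath]
        exact (mem_subgroupAt hL _ _).2 ⟨_, hq, rfl⟩

theorem lift_sigma_iff {L : Subgroup (Wreath G m)} (hL : L.Normal) (x y : PWreath G n) :
    lift (sigma L) x y ↔ WreathRel L x y := by
  constructor
  · rintro ⟨hx, hy, h⟩
    rcases (sigma_coe_iff hL _ _).1 h with h | h
    · exact absurd hx h.1.ne
    · exact h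
  · exact fun h => ⟨h.rank_left, h.rank_right, (sigma_coe_iff hL _ _).2 (Or.inr h)⟩

theorem rankRel_iff_of_rank_le {K : (i : ℕ) → Subgroup (Fin i → G)} {L : Subgroup (Wreath G m)}
    {x y : PWreath G n} (hx : x.rank ≤ m) :
    RankRel m K L x y ↔ (x.rank < m ∧ y.rank < m) ∨ WreathRel L x y := by
  simp [RankRel, hx.not_gt]

/-- On `I_m` the clause of `RankRel` involving `K` is void, so `σ_L` inherits its properties from
`rankCon`. -/
theorem isCongruence_sigma {K : (i : ℕ) → Subgroup (Fin i → G)} (hK : IsClosedFamily n K)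
    {L : Subgroup (Wreath G m)} (hL : L.Normal)
    (hKL : ∀ t ∈ K m, (SemidirectProduct.inl t : Wreath G m) ∈ L) :
    IsCongruence (sigma (n := n) L) := by
  have key : ∀ x y : idealI G n m, sigma L (x : PrincipalFactor G n m) y ↔
      rankCon hK hL hKL (x : PWreath G n) (y : PWreath G n) := fun x y =>
    (sigma_coe_iff hL x y).trans (rankRel_iff_of_rank_le x.2).symm
  refine ⟨⟨⟨sigma L, ?_, ?_, ?_⟩, ?_⟩, fun _ _ => Iff.rfl⟩
  · intro x
    induction x using Con.induction_on with | _ x => exact (key _ _).2 (Con.refl _ _)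
  · intro x y
    induction x using Con.induction_on with | _ x =>
    induction y using Con.induction_on with | _ y =>
    exact fun h => (key _ _).2 (Con.symm _ ((key _ _).1 h))
  · intro x y z
    induction x using Con.induction_on with | _ x =>
    induction y using Con.induction_on with | _ y =>
    induction z using Con.induction_on with | _ z =>
    exact fun h h' => (key _ _).2 (Con.trans _ ((key _ _).1 h) ((key _ _).1 h'))
  · intro w x y z
    induction w using Con.induction_on with | _ w =>
    induction x using Con.induction_on with | _ x =>
    induction y using Con.induction_on with | _ y =>
    induction z using Con.induction_on with | _ z =>
    exact fun h h' => (key (w * y) (x * z)).2 (Con.mul _ ((key _ _).1 h) ((key _ _).1 h'))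

theorem IsDatum.inl_mem {T : (i : ℕ) → Subgroup (Fin i → G)} {L : Subgroup (Wreath G m)}
    (h : IsDatum n m T L) :
    ∀ t ∈ extend n m T m, (SemidirectProduct.inl t : Wreath G m) ∈ L := by
  intro t ht
  simp only [extend, lt_irrefl, if_false, if_true] at ht
  split_ifs at ht with hmn
  · exact h.compat hmn t ht
  · rw [Subgroup.mem_bot.1 ht, map_one]
    exact one_mem _

/-- The pieces of `ρ` overlap: `χ` is contained in the Rees part below rank `m` and in the `L`-part
at rank `m`, so only its part above `m` adds pairs. -/
theorem IsDatum.rho_iff {T : (i : ℕ) → Subgroup (Fin i → G)} {L : Subgroup (Wreath G m)}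
    (h : IsDatum n m T L) (x y : PWreath G n) :
    rho m T L x y ↔ RankRel m (extend n m T) L x y := by
  rw [rho, lift_sigma_iff h.normal_L, h.isClosedFamily.chi_iff]
  constructor
  · rintro ((h' | rfl) | h' | h')
    · exact Or.inl h'
    · exact (LabelRel.refl _ x).rankRel h.normal_L h.inl_mem
    · exact Or.inr (Or.inl h')
    · exact h'.rankRel h.normal_L h.inl_mem
  · rintro (h' | h' | ⟨-, h'⟩)
    · exact Or.inl (Or.inl h')
    · exact Or.inr (Or.inl h')
    · exact Or.inr (Or.inr h')

/-! ### Subgroups induced by a congruence -/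

/-- The normal subgroup of `G ≀ S_k` induced by a congruence on the `H`-class of the idempotent
whose domain is enumerated by `f`. -/
def wreathKer (c : Con (PWreath G n)) (f : Fin k ↪ Fin n) : Subgroup (Wreath G k) where
  carrier := {p | c (ofWreath f f p) (ofWreath f f 1)}
  mul_mem' {p q} hp hq := by
    have := c.mul hp hq
    rwa [ofWreath_mul, ofWreath_mul, mul_one] at this
  one_mem' := c.refl _
  inv_mem' {p} hp := by
    have := c.mul (c.refl (ofWreath f f p⁻¹)) (c.symm hp)
    rwa [ofWreath_mul, ofWreath_mul, mul_one, inv_mul_cancel] at this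

/-- Two-sided translation between `H`-classes of equal rank is reversible, so one subgroup, taken at
any `f₀`, governs them all. -/
theorem con_ofWreath_iff (c : Con (PWreath G n)) (f f' f₀ : Fin k ↪ Fin n) (p q : Wreath G k) :
    c (ofWreath f f' p) (ofWreath f f' q) ↔ p⁻¹ * q ∈ wreathKer c f₀ := by
  constructor
  · intro h
    have := c.mul (c.mul (c.refl (ofWreath f₀ f p⁻¹)) (c.symm h)) (c.refl (ofWreath f' f₀ 1))
    rwa [ofWreath_mul, ofWreath_mul, ofWreath_mul, ofWreath_mul, mul_one, mul_one,
      inv_mul_cancel] at this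
  · intro h
    have h : c (ofWreath f₀ f₀ (p⁻¹ * q)) (ofWreath f₀ f₀ 1) := h
    have := c.mul (c.mul (c.refl (ofWreath f f₀ p)) (c.symm h)) (c.refl (ofWreath f₀ f' 1))
    simpa only [ofWreath_mul, mul_one, mul_inv_cancel_left] using this

theorem wreathKer_normal (c : Con (PWreath G n)) (f : Fin k ↪ Fin n) :
    (wreathKer c f).Normal := by
  refine ⟨fun p hp a => ?_⟩
  have := c.mul (c.mul (c.refl (ofWreath f f a)) hp) (c.refl (ofWreath f f a⁻¹))
  rwa [ofWreath_mul, ofWreath_mul, ofWreath_mul, ofWreath_mul, mul_one, mul_inv_cancel] at this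

/-- Multiplication by the idempotent on the first `k` points forgets the last label; pure label
elements move no points, so the result stays in a group `H`-class. -/
theorem inl_proj_mem_wreathKer (c : Con (PWreath G n)) (f : Fin (k + 1) ↪ Fin n)
    (f₀ : Fin k ↪ Fin n) {t : Fin (k + 1) → G}
    (ht : (SemidirectProduct.inl t : Wreath G (k + 1)) ∈ wreathKer c f) :
    (SemidirectProduct.inl (proj G k t) : Wreath G k) ∈ wreathKer c f₀ := by
  have ht : c (ofEmb f t f) (ofEmb f 1 f) := ht
  let f' : Fin k ↪ Fin n := Fin.castSuccEmb.trans f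
  have h := c.mul (c.refl (ofEmb f' 1 f')) ht
  rw [ofEmb_mul f' 1 ((agrees_ofEmb f t f).comp Fin.castSuccEmb),
    ofEmb_mul f' 1 ((agrees_ofEmb f 1 f).comp Fin.castSuccEmb)] at h
  have := (con_ofWreath_iff c f' f' f₀ 1 (SemidirectProduct.inl (proj G k t))).1 (c.symm ?_)
  · simpa using this
  · rw [one_mul, one_mul] at h
    exact h

theorem permInvariant_comap_inl {L : Subgroup (Wreath G k)} (hL : L.Normal) :
    PermInvariant (L.comap (SemidirectProduct.inl : (Fin k → G) →* Wreath G k)) := by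
  have key : ∀ (s : Equiv.Perm (Fin k)) (g : Fin k → G),
      (SemidirectProduct.inl g : Wreath G k) ∈ L →
      (SemidirectProduct.inl (fun i => g (s i)) : Wreath G k) ∈ L := by
    intro s g hg
    have := hL.conj_mem _ hg (SemidirectProduct.inr (MulOpposite.op s))
    -- Conjugation by a permutation permutes the coordinates.
    rw [← map_inv, ← SemidirectProduct.inl_aut] at this
    exact this
  refine fun s g => ⟨key s g, fun h => ?_⟩
  simpa using key s⁻¹ _ h

/-- The family of subgroups `T_i` of `G^i` induced by a congruence. -/
def labelKer (c : Con (PWreath G n)) (i : ℕ) : Subgroup (Fin i → G) :=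
  -- For `i > n` there is no embedding into `Fin n`; `⊥` is a default value.
  if h : i ≤ n then (wreathKer c (Fin.castLEEmb h)).comap SemidirectProduct.inl else ⊥

theorem mem_labelKer (c : Con (PWreath G n)) (hk : k ≤ n) (f₀ : Fin k ↪ Fin n) (t : Fin k → G) :
    t ∈ labelKer c k ↔ (SemidirectProduct.inl t : Wreath G k) ∈ wreathKer c f₀ := by
  rw [labelKer, dif_pos hk, Subgroup.mem_comap]
  have h1 := con_ofWreath_iff c f₀ f₀ (Fin.castLEEmb hk) 1 (SemidirectProduct.inl t)
  have h2 := con_ofWreath_iff c f₀ f₀ f₀ 1 (SemidirectProduct.inl t)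
  rw [inv_one, one_mul] at h1 h2
  exact h1.symm.trans h2

theorem isDatum_ker (c : Con (PWreath G n)) (hm : m ≤ n) :
    IsDatum n m (labelKer c) (wreathKer c (Fin.castLEEmb hm : Fin m ↪ Fin n)) where
  normal i _ hi := by
    rw [labelKer, dif_pos hi]
    exact (wreathKer_normal c _).comap _
  invariant i _ hi := by
    rw [labelKer, dif_pos hi]
    exact permInvariant_comap_inl (wreathKer_normal c _)
  closed i _ hi := by
    rintro _ ⟨t, ht, rfl⟩
    rw [mem_labelKer c (by omega) (Fin.castLEEmb (by omega : i ≤ n))]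
    exact inl_proj_mem_wreathKer c (Fin.castLEEmb hi) _ ((mem_labelKer c hi _ t).1 ht)
  normal_L := wreathKer_normal c _
  compat hmn := by
    rintro _ ⟨t, ht, rfl⟩
    exact inl_proj_mem_wreathKer c (Fin.castLEEmb hmn) _ ((mem_labelKer c hmn _ t).1 ht)

/-! ### The critical rank -/

/-- All elements of rank at most `k` are related. -/
def Collapses (c : Con (PWreath G n)) (k : ℕ) : Prop :=
  ∀ x y : PWreath G n, x.rank ≤ k → y.rank ≤ k → c x y

theorem collapses_zero (c : Con (PWreath G n)) : Collapses c 0 := by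
  intro x y hx hy
  obtain ⟨f, g, f', rfl⟩ := exists_eq_ofEmb (Nat.le_zero.1 hx)
  obtain ⟨f₁, g₁, f₁', rfl⟩ := exists_eq_ofEmb (Nat.le_zero.1 hy)
  rw [Subsingleton.elim f₁ f, Subsingleton.elim g₁ g, Subsingleton.elim f₁' f']
  exact c.refl _

/-- The least rank that is not collapsed. -/
theorem exists_critical_rank {c : Con (PWreath G n)} (hc : c ≠ ⊤) :
    ∃ m, 1 ≤ m ∧ m ≤ n ∧ (∀ x y : PWreath G n, x.rank < m → y.rank < m → c x y) ∧
      ¬ Collapses c m := by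
  classical
  have hn : ¬ Collapses c n := fun h =>
    hc (Con.ext fun x y => ⟨fun _ => trivial, fun _ => h x y (rank_le x) (rank_le y)⟩)
  have hex : ∃ k, ¬ Collapses c k := ⟨n, hn⟩
  have h1 : 1 ≤ Nat.find hex := by
    rw [Nat.one_le_iff_ne_zero]
    intro h
    exact Nat.find_spec hex (h ▸ collapses_zero c)
  refine ⟨Nat.find hex, h1, Nat.find_min' hex hn, fun x y hx hy => ?_, Nat.find_spec hex⟩
  have := Nat.find_min hex (Nat.sub_one_lt (Nat.one_le_iff_ne_zero.1 h1))
  exact not_not.1 this x y (by omega) (by omega)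

section Critical

variable {c : Con (PWreath G n)}

/-- An element of the critical rank is not related to an element of smaller rank. -/
theorem not_rank_lt_of_con (hlt : ∀ x y : PWreath G n, x.rank < m → y.rank < m → c x y)
    (hm : ¬ Collapses c m) {x y : PWreath G n} (hx : x.rank = m) (h : c x y) :
    ¬ y.rank < m := by
  intro hy
  obtain ⟨f, f', p, rfl⟩ := exists_eq_ofWreath hx
  have key : ∀ z : PWreath G n, z.rank ≤ m → c z y := by
    intro z hz
    rcases hz.lt_or_eq with hz | hz
    · exact hlt _ _ hz hy
    · obtain ⟨f₁, f₁', p₁, rfl⟩ := exists_eq_ofWreath hz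
      -- Sandwiching carries the rank `m` element to an arbitrary one of rank `m`, while `y` stays
      -- below rank `m`.
      have h1 := c.mul (c.mul (c.refl (ofWreath f₁ f p₁)) h) (c.refl (ofWreath f' f₁' p⁻¹))
      rw [ofWreath_mul, ofWreath_mul, mul_inv_cancel_right] at h1
      exact c.trans h1 (hlt _ _ ((rank_mul_le_left _ _).trans_lt
        ((rank_mul_le_right _ _).trans_lt hy)) hy)
  exact hm fun a b ha hb => c.trans (key a ha) (c.symm (key b hb))

/-- Cut both elements down by the idempotents on the ranges of `f` and `f'`. If `y` missed a point
of `f`, or left the range of `f'`, only its side would fall below rank `m`. -/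
theorem agrees_of_con (hlt : ∀ x y : PWreath G n, x.rank < m → y.rank < m → c x y)
    (hm : ¬ Collapses c m) {x y : PWreath G n} (h : c x y) {f f' : Fin m ↪ Fin n}
    {g : Fin m → G} (hx : Agrees x f g f') :
    ∃ (s : Equiv.Perm (Fin m)) (g' : Fin m → G), Agrees y f g' (s.toEmbedding.trans f') := by
  have hy : ∀ j, f j ∈ y.dom := by
    by_contra! hj
    obtain ⟨j, hj⟩ := hj
    have h1 := c.mul (c.refl (ofWreath f f 1)) h
    rw [ofWreath_mul_agrees hx] at h1
    exact not_rank_lt_of_con hlt hm (rank_ofWreath _ _ _) h1 (rank_ofWreath_mul_lt hj 1)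
  obtain ⟨g', f'', hy⟩ := exists_agrees hy
  have h1 := c.mul (c.mul (c.refl (ofWreath f f 1)) h) (c.refl (ofWreath f' f' 1))
  rw [ofWreath_mul_agrees hx, ofWreath_mul_agrees hy, ofWreath_mul] at h1
  have h2 : ∀ j, ∃ i, f' i = f'' j := by
    by_contra! hj
    obtain ⟨j, hj⟩ := hj
    refine not_rank_lt_of_con hlt hm (rank_ofWreath _ _ _) h1 (rank_ofWreath_mul_lt (j := j) ?_ _)
    exact fun hd => (mem_dom_ofWreath.1 hd).elim hj
  obtain ⟨s, rfl⟩ := exists_perm_trans h2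
  exact ⟨s, g', hy⟩

theorem exists_enum {A : Finset (Fin n)} (hA : A.card = k) :
    ∃ f : Fin k ↪ Fin n, (∀ j, f j ∈ A) ∧ ∀ i ∈ A, ∃ j, f j = i :=
  ⟨(A.orderEmbOfFin hA).toEmbedding, fun j => A.orderEmbOfFin_mem hA j, fun _ hi =>
    exists_apply_eq (fun j => A.orderEmbOfFin_mem hA j) hA.le hi⟩

theorem dom_subset_of_con (h1 : 1 ≤ m)
    (hlt : ∀ x y : PWreath G n, x.rank < m → y.rank < m → c x y)
    (hm : ¬ Collapses c m) {x y : PWreath G n} (h : c x y) (hx : m ≤ x.rank) :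
    x.dom ⊆ y.dom := by
  intro i hi
  -- As `m ≥ 1`, each point of the domain lies in some `m`-subset of it.
  obtain ⟨A, hiA, hAx, hA⟩ := Finset.exists_subsuperset_card_eq
    (Finset.singleton_subset_iff.2 hi) (by simpa using h1) hx
  obtain ⟨f, hf, hf'⟩ := exists_enum hA
  obtain ⟨j, rfl⟩ := hf' i (hiA (Finset.mem_singleton_self i))
  obtain ⟨g, f', hg⟩ := exists_agrees fun j => hAx (hf j)
  obtain ⟨s, g', hy⟩ := agrees_of_con hlt hm h hg
  exact hy.mem_dom j

theorem dom_eq_of_con (h1 : 1 ≤ m)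
    (hlt : ∀ x y : PWreath G n, x.rank < m → y.rank < m → c x y)
    (hm : ¬ Collapses c m) {x y : PWreath G n} (h : c x y) (hx : m ≤ x.rank) :
    x.dom = y.dom := by
  have hs := dom_subset_of_con h1 hlt hm h hx
  exact hs.antisymm (dom_subset_of_con h1 hlt hm (c.symm h) (hx.trans (Finset.card_le_card hs)))

theorem map_eq_of_con (h1 : 1 ≤ m)
    (hlt : ∀ x y : PWreath G n, x.rank < m → y.rank < m → c x y)
    (hm : ¬ Collapses c m) {x y : PWreath G n} (h : c x y) (hx : m < x.rank) :
    x.map = y.map := by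
  have hd := dom_eq_of_con h1 hlt hm h hx.le
  ext1 i
  by_cases hi : i ∈ x.dom
  swap
  · rw [map_eq_none hi, map_eq_none (hd ▸ hi)]
  obtain ⟨a, ha⟩ := mem_dom.1 hi
  obtain ⟨b, hb⟩ := mem_dom.1 (hd ▸ hi)
  by_contra hab
  -- Discarding the `y`-preimage of `a`, which is not `i`, leaves at least `m` points because the
  -- rank exceeds `m`. On an `m`-subset through `i`, the image under `x` contains `a` and that under
  -- `y` does not, against `agrees_of_con`.
  have hB : ∃ B ⊆ x.dom, i ∈ B ∧ m ≤ B.card ∧ ∀ j ∈ B, y.map j ≠ some a := by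
    by_cases hj : ∃ j, y.map j = some a
    · obtain ⟨j, hj⟩ := hj
      have hij : i ≠ j := by
        rintro rfl
        exact hab (ha.trans hj.symm)
      refine ⟨x.dom.erase j, Finset.erase_subset _ _, Finset.mem_erase.2 ⟨hij, hi⟩, ?_, ?_⟩
      · exact Nat.le_trans (Nat.le_sub_one_of_lt hx) Finset.pred_card_le_card_erase
      · exact fun j' hj' h => (Finset.mem_erase.1 hj').1 (map_inj h hj)
    · push Not at hj
      exact ⟨x.dom, subset_rfl, hi, hx.le, fun j _ => hj j⟩
  obtain ⟨B, hBx, hiB, hBm, hBa⟩ := hB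
  obtain ⟨A, hiA, hAB, hA⟩ := Finset.exists_subsuperset_card_eq
    (Finset.singleton_subset_iff.2 hiB) (by simpa using h1) hBm
  obtain ⟨f, hf, hf'⟩ := exists_enum hA
  obtain ⟨j, rfl⟩ := hf' i (hiA (Finset.mem_singleton_self i))
  obtain ⟨g, f', hg⟩ := exists_agrees fun j => hBx (hAB (hf j))
  obtain ⟨s, g', hy⟩ := agrees_of_con hlt hm h hg
  refine hBa (f (s⁻¹ j)) (hAB (hf _)) ?_
  rw [(hy (s⁻¹ j)).2, ← ha, (hg j).2]
  simp

theorem IsClosedFamily.labelRel_ofEmb {K : (i : ℕ) → Subgroup (Fin i → G)}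
    (hK : IsClosedFamily n K) (f f' : Fin k ↪ Fin n) (g h : Fin k → G) :
    LabelRel K (ofEmb f g f') (ofEmb f h f') ↔ h⁻¹ * g ∈ K k := by
  have hk : k ≤ n := by simpa using Fintype.card_le_of_embedding f
  constructor
  · rintro ⟨-, h'⟩
    obtain ⟨t, ht, h'⟩ := h' k f fun j => mem_dom_ofEmb.2 ⟨j, rfl⟩
    suffices h⁻¹ * g = t by rwa [this]
    rw [inv_mul_eq_iff_eq_mul]
    funext j
    have := h' j
    rw [(agrees_ofEmb f g f' j).1, (agrees_ofEmb f h f' j).1] at this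
    exact_mod_cast this
  · refine fun ht => ⟨rfl, fun r f₁ hf₁ => ?_⟩
    choose s hs using fun j => mem_dom_ofEmb.1 (hf₁ j)
    refine ⟨_, hK.comp_mem hk ht ⟨s, fun i j hij => f₁.injective ?_⟩, fun j => ?_⟩
    · rw [← hs, ← hs, hij]
    · rw [← hs, (agrees_ofEmb f g f' _).1, (agrees_ofEmb f h f' _).1, ← WithZero.coe_mul]
      exact congrArg _ (mul_inv_cancel_left (h (s j)) (g (s j))).symm

/-- Elements with the same underlying partial bijection are related exactly when their labels
differ by an element of the corresponding subgroup. -/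
theorem con_iff_labelRel {K : (i : ℕ) → Subgroup (Fin i → G)} (hK : IsClosedFamily n K)
    {x y : PWreath G n} (hmap : x.map = y.map) (hKx : K x.rank = labelKer c x.rank) :
    c x y ↔ LabelRel K x y := by
  obtain ⟨f, g, f', hx⟩ := exists_eq_ofEmb (rfl : x.rank = x.rank)
  have hyx := rank_eq_of_map_eq hmap
  generalize hr : x.rank = r at *
  subst hx
  have hdom := dom_eq_of_map_eq hmap
  have hrn : r ≤ n := hr ▸ rank_le _
  obtain ⟨h, f'', hh⟩ := exists_agrees (x := y) fun j =>
    hdom ▸ mem_dom_ofEmb.2 ⟨j, rfl⟩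
  have hff : f'' = f' := by
    ext1 j
    have h2 := (hh j).2
    rw [← hmap, (agrees_ofEmb f g f' j).2] at h2
    exact (Option.some.inj h2).symm
  subst hff
  obtain rfl := hh.eq_ofEmb_of_rank_le hyx.symm.le
  rw [hK.labelRel_ofEmb, hKx, mem_labelKer c hrn f, map_mul, map_inv,
    ← con_ofWreath_iff c f f'' f, ofWreath_inl, ofWreath_inl]
  exact ⟨c.symm, c.symm⟩

theorem con_iff_rankRel (h1 : 1 ≤ m) (hmn : m ≤ n)
    (hlt : ∀ x y : PWreath G n, x.rank < m → y.rank < m → c x y)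
    (hm : ¬ Collapses c m) (x y : PWreath G n) :
    c x y ↔ RankRel m (extend n m (labelKer c))
      (wreathKer c (Fin.castLEEmb hmn : Fin m ↪ Fin n)) x y := by
  have hK := (isDatum_ker c hmn).isClosedFamily
  have hKx : ∀ {r}, m < r → extend n m (labelKer c) r = labelKer c r := fun h => by
    simp [extend, h.not_gt, h.ne']
  constructor
  · intro h
    rcases lt_trichotomy x.rank m with hx | hx | hx
    · refine Or.inl ⟨hx, ?_⟩
      by_contra hy
      -- A partner of rank at least `m` would force equal domains, hence equal ranks.
      have := dom_eq_of_con h1 hlt hm (c.symm h) (not_lt.1 hy)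
      rw [rank, this] at hy
      exact hy hx
    · have hd := dom_eq_of_con h1 hlt hm h hx.ge
      have hy : y.rank = m := by rw [rank, ← hd]; exact hx
      obtain ⟨f, g, f', rfl⟩ := exists_eq_ofEmb hx
      obtain ⟨s, g', hg⟩ := agrees_of_con hlt hm h (agrees_ofEmb f g f')
      have hye : y = ofWreath f f' ⟨g', MulOpposite.op s⟩ := hg.eq_ofEmb_of_rank_le hy.le
      subst hye
      rw [← ofWreath_inl] at h ⊢
      exact Or.inr (Or.inl ⟨f, f', _, _, (con_ofWreath_iff c _ _ _ _ _).1 h, rfl, rfl⟩)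
    · exact Or.inr (Or.inr ⟨hx, (con_iff_labelRel hK
        (map_eq_of_con h1 hlt hm h hx) (hKx hx)).1 h⟩)
  · rintro (h | ⟨f, f', p, q, h, rfl, rfl⟩ | ⟨hx, h⟩)
    · exact hlt _ _ h.1 h.2
    · exact (con_ofWreath_iff c _ _ _ _ _).2 h
    · exact (con_iff_labelRel hK h.1 (hKx hx)).2 h

end Critical

end PWreath

theorem theorem3 (G : Type*) [Group G] (n : ℕ) :
    (∀ (m : ℕ) (T : (i : ℕ) → Subgroup (Fin i → G)) (L : Subgroup (PWreath.Wreath G m)),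
      m ≤ n → PWreath.IsDatum n m T L →
        PWreath.IsCongruence (PWreath.rees (G := G) (n := n) m) ∧
        PWreath.IsCongruence (PWreath.sigma (n := n) L) ∧
        (PWreath.IsCongruence (PWreath.chi (n := n) (PWreath.extend n m T)) ∧
          PWreath.IdempotentSeparating (PWreath.chi (n := n) (PWreath.extend n m T))) ∧
        PWreath.IsCongruence (PWreath.rho (n := n) m T L)) ∧
    (∀ c : Con (PWreath G n), c ≠ ⊤ →
      ∃ (m : ℕ) (T : (i : ℕ) → Subgroup (Fin i → G)) (L : Subgroup (PWreath.Wreath G m)),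
        1 ≤ m ∧ m ≤ n ∧ PWreath.IsDatum n m T L ∧
          ∀ x y, c x y ↔ PWreath.rho m T L x y) := by
  refine ⟨fun m T L _ h => ?_, fun c hc => ?_⟩
  · exact ⟨PWreath.isCongruence_rees m,
      PWreath.isCongruence_sigma h.isClosedFamily h.normal_L h.inl_mem,
      ⟨h.isClosedFamily.isCongruence_chi, PWreath.idempotentSeparating_chi _⟩,
      PWreath.rankCon h.isClosedFamily h.normal_L h.inl_mem, fun x y => (h.rho_iff x y).symm⟩
  · obtain ⟨m, h1, hmn, hlt, hm⟩ := PWreath.exists_critical_rank hc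
    have hd := PWreath.isDatum_ker c hmn
    exact ⟨m, PWreath.labelKer c, _, h1, hmn, hd, fun x y =>
      (PWreath.con_iff_rankRel h1 hmn hlt hm x y).trans (hd.rho_iff x y).symm⟩
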